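/- **Model.** Consider $n$ nodes, of which at most $f<n/2$ may crash, communicating over reliable FIFO point-to-point channels (each node also has a channel to itself). Each node runs a sequential client thread, which may have one pending $\mathrm{Update}(v)$ or $\mathrm{Scan}()$ operation at a time, and message handlers, which are executed atomically. A node may crash at any time, also in the middle of "send to all", in which case only some of the messages are sent; a message whose sending was completed is delivered even if its sender crashes later, unless the receiver crashes first. Local computation takes no time, and every message sent (by any node) is handled by its receiver within time $D>0$ of being sent, unless the receiver crashes first. $D$ is unknown to the nodes. Let $k\le f$ be the number of nodes that crash in the execution. **Algorithm AC-ASO (code for node $i$).** The variables are a vector $V[1..n]$ of sets of values, initially empty, where each value carries a timestamp $\langle \mathit{tag},\mathit{writer}\rangle$; an integer $\mathit{maxTag}=0$; and a vector $D[1..n]$ of borrowed views, initially empty. For a set $H$ of values, $H^{\le r}$ is the set of values in $H$ with tag at most $r$, and $V^{\le r}=(V[1]^{\le r},\dots,V[n]^{\le r})$. The predicate $\mathrm{EQ}(W,i)$ says that $W[j]=W[i]$ for at least $n-f$ indices $j$. - $\mathrm{Update}(v)$: $r\gets \mathrm{readTag}()$; send $(\text{value},\langle v,\langle r+1,i\rangle\rangle)$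 to all; run $\mathrm{Lattice}(r)$; run $\mathrm{LatticeRenewal}(\max\{r+1,\mathit{maxTag}\})$; return. - $\mathrm{Scan}()$: $r\gets\mathrm{readTag}()$; $S\gets\mathrm{LatticeRenewal}(r)$; return the vector of the values with largest tag of each writer in $S$. - $\mathrm{Lattice}(r)$ (a *lattice operation* with tag $r$): run $\mathrm{writeTag}(r)$; wait until $\mathrm{EQ}(V^{\le r},i)$ holds for the first time. At that moment, atomically: if $\mathit{maxTag}\le r$, send $(\text{goodLA},r)$ to all and return $(\mathrm{true},V[i]^{\le r})$; otherwise return $(\mathrm{false},\emptyset)$. - $\mathrm{LatticeRenewal}(r)$: in at most three phases, run $\mathrm{Lattice}(r)$ and return its view if its status is true; if it is false in phase 1 or 2, set $r\gets\mathit{maxTag}$ and go to the next phase. If phase 3 also fails, wait until $(\text{goodLA},r)$ has been received from some $j$, and return $D[j]$. - $\mathrm{readTag}()$: send (readTag) to all, wait for $n-f$ answers (readAck), return the largest tag in the received answers. $\mathrm{writeTag}(r)$: send $(\text{writeTag},r)$ to all, wait for $n-f$ answers (writeAck). - Handlers, for a message received from $j$. $(\text{value},x)$: add $x$ to $V[j]$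 and $V[i]$, and send $(\text{value},x)$ to all if $i$ has not sent $x$ to all before. $(\text{writeTag},t)$: $\mathit{maxTag}\gets\max\{\mathit{maxTag},t\}$, send $(\text{echoTag},t)$ to all, answer writeAck. $(\text{echoTag},t)$: $\mathit{maxTag}\gets\max\{\mathit{maxTag},t\}$. (readTag): answer $(\text{readAck},\mathit{maxTag})$. $(\text{goodLA},r)$: $D[j]\gets V[j]^{\le r}$. **Lemma.** There is an absolute constant $C>0$ such that in every execution of AC-ASO, for every $n$, every $f<n/2$ and every $D>0$, with $k\le f$ the number of crashes that actually occur: 1. every lattice operation that starts at a time $t$ returns by time $t+C\max\{1,\sqrt k\}\,D$, unless the node that runs it crashes by that time; 2. every $\mathrm{Update}$ and $\mathrm{Scan}$ operation invoked at a time $t$ returns by time $t+C\max\{1,\sqrt k\}\,D$, unless the node that invoked it crashes by that time. So lattice operations, $\mathrm{Update}$ and $\mathrm{Scan}$ take $O(\sqrt k)$ message delays in the worst case, and $O(1)$ message delays if no node crashes. -/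

import Mathlib

namespace ACASO

universe u

/-! ## Values, views and the equivalence-quorum predicate -/

/-- A written value together with its timestamp `⟨tag, writer⟩`. -/
@[ext]
structure Value (Val : Type u) (n : ℕ) where
  val : Val
  tag : ℕ
  writer : Fin n

/-- A view is a set of timestamped values. -/
abbrev View (Val : Type u) (n : ℕ) := Set (Value Val n)

/-- `H^{≤ r}`: the values of `H` with tag at most `r`. -/
def View.upTo {Val : Type u} {n : ℕ} (H : View Val n) (r : ℕ) : View Val n :=
  {x ∈ H | x.tag ≤ r}

/-- The predicate `EQ(W, i)`: at least `n - f` entries of the vector `W` equal `W i`. -/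
def EQ {α : Type u} {n : ℕ} (f : ℕ) (W : Fin n → α) (i : Fin n) : Prop :=
  ∃ Q : Finset (Fin n), n - f ≤ Q.card ∧ ∀ j ∈ Q, W j = W i

open Classical in
/-- `extract S`: for each node `j`, the value of `j` in `S` with the largest tag
(`none` stands for the initial value). -/
noncomputable def extract {Val : Type u} {n : ℕ} (S : View Val n) (j : Fin n) : Option Val :=
  if h : ∃ x ∈ S, x.writer = j ∧ ∀ y ∈ S, y.writer = j → y.tag ≤ x.tag then
    some h.choose.val
  else none

/-! ## Messages and local states -/

/-- The messages of the algorithm. The last argument of `readTag`, `readAck`, `writeTag`,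
`writeAck` identifies the request, so that acknowledgements are matched with the request
that they answer. -/
inductive Msg (Val : Type u) (n : ℕ) where
  | value (x : Value Val n)
  | readTag (q : ℕ)
  | readAck (tag q : ℕ)
  | writeTag (tag q : ℕ)
  | writeAck (tag q : ℕ)
  | echoTag (tag : ℕ)
  | goodLA (r : ℕ)

/-- Send commands: "send `m` to all" (the sender included) and "send `m` to `j`". -/
inductive Send (Val : Type u) (n : ℕ) where
  | toAll (m : Msg Val n)
  | to (j : Fin n) (m : Msg Val n)

/-- The operations of the snapshot object. -/
inductive Op (Val : Type u) where
  | update (v : Val)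
  | scan

/-- Program counter of the client thread. `op` is the pending operation, `r` the tag of the
current lattice operation, and `ph` its phase: `0` for the initial lattice operation of an
`Update`, and `1, 2, 3` for the iterations of the loop of `LatticeRenewal`. -/
inductive PC (Val : Type u) (n : ℕ) where
  /-- no pending operation -/
  | idle
  /-- inside `readTag()`, waiting for acknowledgements -/
  | readWait (op : Op Val)
  /-- about to call `Lattice(r)` -/
  | latticeCall (op : Op Val) (ph r : ℕ)
  /-- inside `Lattice(r)`, in `writeTag(r)`, waiting for acknowledgements -/
  | writeWait (op : Op Val) (ph r : ℕ)
  /-- inside `Lattice(r)`, waiting for the equivalence quorum -/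
  | eqWait (op : Op Val) (ph r : ℕ)
  /-- `Lattice(r)` has returned: `some view` for `(true, view)`, `none` for `(false, ∅)` -/
  | latticeRet (op : Op Val) (ph r : ℕ) (res : Option (View Val n))
  /-- after the loop of `LatticeRenewal`, waiting for a `goodLA` message with tag `r` -/
  | borrowWait (op : Op Val) (r : ℕ)

/-- The local state of a node. -/
structure NodeState (Val : Type u) (n : ℕ) where
  /-- `V j`: the values received from `j`; at node `i` itself, `V i` is the set of all
  received values -/
  V : Fin n → View Val n
  /-- the largest tag seen in `writeTag` and `echoTag` messages -/
  maxTag : ℕ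
  /-- the vector `D` of borrowed views -/
  borrowed : Fin n → View Val n
  /-- the values this node has already sent to all (as their writer or as a forwarder) -/
  sent : Set (Value Val n)
  /-- the pairs `(j, r)` such that `(goodLA, r)` has been received from `j` -/
  goodLAs : Set (Fin n × ℕ)
  /-- number of the current `readTag` / `writeTag` request -/
  req : ℕ
  /-- the nodes whose acknowledgement of the current request has been received -/
  acks : Finset (Fin n)
  /-- largest tag in the received acknowledgements of the current `readTag` request -/
  ackTag : ℕ
  pc : PC Val n
  /-- the vector returned by the last completed `Scan` -/
  scanResult : Option (Fin n → Option Val)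

/-- The initial local state. -/
def NodeState.init (Val : Type u) (n : ℕ) : NodeState Val n where
  V := fun _ => ∅
  maxTag := 0
  borrowed := fun _ => ∅
  sent := ∅
  goodLAs := ∅
  req := 0
  acks := ∅
  ackTag := 0
  pc := .idle
  scanResult := none

/-! ## The code of a node -/

open Classical in
/-- The (atomic) event handlers: node `i` in state `s` receives `m` from `j`. The result is the
new state and the list of send commands executed by the handler, in order. -/
noncomputable def handle {Val : Type u} {n : ℕ} (i j : Fin n) (m : Msg Val n)
    (s : NodeState Val n) : NodeState Val n × List (Send Val n) :=
  match m with
  | .value x =>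
      ({ s with
          V := fun l => if l = j ∨ l = i then insert x (s.V l) else s.V l
          sent := insert x s.sent },
        if x ∈ s.sent then [] else [.toAll (.value x)])
  | .writeTag tag q =>
      ({ s with maxTag := max s.maxTag tag }, [.toAll (.echoTag tag), .to j (.writeAck tag q)])
  | .echoTag tag => ({ s with maxTag := max s.maxTag tag }, [])
  | .readTag q => (s, [.to j (.readAck s.maxTag q)])
  | .goodLA r =>
      ({ s with
          borrowed := Function.update s.borrowed j ((s.V j).upTo r)
          goodLAs := insert (j, r) s.goodLAs }, [])
  | .readAck tag q =>
      (if q = s.req then { s with acks := insert j s.acks, ackTag := max s.ackTag tag } else s, [])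
  | .writeAck _ q =>
      (if q = s.req then { s with acks := insert j s.acks } else s, [])

/-- State after issuing a new `readTag` / `writeTag` request and moving to `pc`. -/
def NodeState.newRequest {Val : Type u} {n : ℕ} (s : NodeState Val n) (pc : PC Val n) :
    NodeState Val n :=
  { s with req := s.req + 1, acks := ∅, ackTag := 0, pc := pc }

/-- State after the pending operation `op` has returned, where `view` is the view returned by
its `LatticeRenewal`: `Update` discards it, `Scan` returns `extract view`. -/
noncomputable def NodeState.finish {Val : Type u} {n : ℕ} (s : NodeState Val n) (op : Op Val)
    (view : View Val n) : NodeState Val n :=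
  match op with
  | .update _ => { s with pc := .idle }
  | .scan => { s with pc := .idle, scanResult := some (extract view) }

/-- The steps of the client thread of node `i` while an operation is pending:
`ClientStep f i s s' out` means that the next step from state `s` is not blocked, leads to `s'`
and executes the send commands `out`. -/
inductive ClientStep {Val : Type u} {n : ℕ} (f : ℕ) (i : Fin n) :
    NodeState Val n → NodeState Val n → List (Send Val n) → Prop where
  /-- `Update(v)`: `readTag()` returns `r`; send `⟨v, ⟨r + 1, i⟩⟩` to all; go on to `Lattice(r)` -/
  | readDoneUpdate (s : NodeState Val n) (v : Val) (h : s.pc = .readWait (.update v))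
      (hq : n - f ≤ s.acks.card) :
      ClientStep f i s
        { s with
          sent := insert ⟨v, s.ackTag + 1, i⟩ s.sent
          pc := .latticeCall (.update v) 0 s.ackTag }
        [.toAll (.value ⟨v, s.ackTag + 1, i⟩)]
  /-- `Scan()`: `readTag()` returns `r`; go on to `LatticeRenewal(r)` -/
  | readDoneScan (s : NodeState Val n) (h : s.pc = .readWait .scan)
      (hq : n - f ≤ s.acks.card) :
      ClientStep f i s { s with pc := .latticeCall .scan 1 s.ackTag } []
  /-- `Lattice(r)` starts: send `(writeTag, r)` to all -/
  | latticeStart (s : NodeState Val n) (op : Op Val) (ph r : ℕ)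
      (h : s.pc = .latticeCall op ph r) :
      ClientStep f i s (s.newRequest (.writeWait op ph r)) [.toAll (.writeTag r (s.req + 1))]
  /-- `writeTag(r)` has been acknowledged by `n - f` nodes -/
  | writeDone (s : NodeState Val n) (op : Op Val) (ph r : ℕ)
      (h : s.pc = .writeWait op ph r) (hq : n - f ≤ s.acks.card) :
      ClientStep f i s { s with pc := .eqWait op ph r } []
  /-- the equivalence quorum is there and no larger tag is known: the lattice operation is good -/
  | latticeGood (s : NodeState Val n) (op : Op Val) (ph r : ℕ)
      (h : s.pc = .eqWait op ph r) (hEQ : EQ f (fun j => (s.V j).upTo r) i)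
      (ht : s.maxTag ≤ r) :
      ClientStep f i s { s with pc := .latticeRet op ph r (some ((s.V i).upTo r)) }
        [.toAll (.goodLA r)]
  /-- the equivalence quorum is there but a larger tag is known -/
  | latticeBad (s : NodeState Val n) (op : Op Val) (ph r : ℕ)
      (h : s.pc = .eqWait op ph r) (hEQ : EQ f (fun j => (s.V j).upTo r) i)
      (ht : r < s.maxTag) :
      ClientStep f i s { s with pc := .latticeRet op ph r none } []
  /-- after the initial lattice operation of an `Update`: `LatticeRenewal(max{r + 1, maxTag})` -/
  | afterPhaseZero (s : NodeState Val n) (op : Op Val) (r : ℕ) (res : Option (View Val n))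
      (h : s.pc = .latticeRet op 0 r res) :
      ClientStep f i s { s with pc := .latticeCall op 1 (max (r + 1) s.maxTag) } []
  /-- direct view -/
  | direct (s : NodeState Val n) (op : Op Val) (ph r : ℕ) (view : View Val n)
      (h : s.pc = .latticeRet op ph r (some view)) (hph : 1 ≤ ph) :
      ClientStep f i s (s.finish op view) []
  /-- phase 1 or 2 was not good: next phase, with `r ← maxTag` -/
  | nextPhase (s : NodeState Val n) (op : Op Val) (ph r : ℕ)
      (h : s.pc = .latticeRet op ph r none) (hph : ph = 1 ∨ ph = 2) :
      ClientStep f i s { s with pc := .latticeCall op (ph + 1) s.maxTag } []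
  /-- phase 3 was not good: leave the loop -/
  | leaveLoop (s : NodeState Val n) (op : Op Val) (r : ℕ)
      (h : s.pc = .latticeRet op 3 r none) :
      ClientStep f i s { s with pc := .borrowWait op r } []
  /-- indirect view -/
  | indirect (s : NodeState Val n) (op : Op Val) (r : ℕ) (j : Fin n)
      (h : s.pc = .borrowWait op r) (hj : (j, r) ∈ s.goodLAs) :
      ClientStep f i s (s.finish op (s.borrowed j)) []

/-- The client thread of `i` waits for the equivalence quorum and the predicate holds. -/
def EQReady {Val : Type u} {n : ℕ} (f : ℕ) (i : Fin n) (s : NodeState Val n) : Prop :=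
  ∃ op ph r, s.pc = .eqWait op ph r ∧ EQ f (fun j => (s.V j).upTo r) i

/-! ## The system: reliable FIFO channels, crashes, real time -/

/-- A configuration of the system. `chan i j` is the content of the FIFO channel from `i` to `j`
(oldest message first), each message with the time at which it was sent. -/
structure Config (Val : Type u) (n : ℕ) where
  state : Fin n → NodeState Val n
  crashed : Set (Fin n)
  chan : Fin n → Fin n → List (Msg Val n × ℝ)
  now : ℝ

/-- The initial configuration. -/
def Config.init (Val : Type u) (n : ℕ) : Config Val n where
  state := fun _ => .init Val n
  crashed := ∅
  chan := fun _ _ => []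
  now := 0

/-- The point-to-point sends that a list of send commands consists of; "send to all" serves the
receivers in the order `order`. -/
def packets {Val : Type u} {n : ℕ} (order : Equiv.Perm (Fin n)) (out : List (Send Val n)) :
    List (Fin n × Msg Val n) :=
  out.flatMap fun c =>
    match c with
    | .toAll m => (List.finRange n).map fun j => (order j, m)
    | .to j m => [(j, m)]

/-- Put point-to-point messages of `i` into its outgoing channels. -/
def Config.post {Val : Type u} {n : ℕ} (c : Config Val n) (i : Fin n)
    (ps : List (Fin n × Msg Val n)) : Config Val n :=
  { c with
    chan := Function.update c.chan i fun j =>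
      c.chan i j ++ (ps.filter fun p => p.1 = j).map fun p => (p.2, c.now) }

/-- Node `i` executes an atomic step with new state `s'` and send commands `out`.
`cut = none`: the step is completed. `cut = some l`: node `i` crashes during the step, when
exactly its first `l` point-to-point sends have been completed. -/
def Config.perform {Val : Type u} {n : ℕ} (c : Config Val n) (i : Fin n)
    (s' : NodeState Val n) (out : List (Send Val n)) (order : Equiv.Perm (Fin n))
    (cut : Option ℕ) : Config Val n :=
  match cut with
  | none => { c.post i (packets order out) with state := Function.update c.state i s' }
  | some l =>
      { c.post i ((packets order out).take l) with
        state := Function.update c.state i s'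
        crashed := insert i c.crashed }

/-- The steps of the system, for executions with message delay at most `D`. Local computation
takes no time: time passes only while all client threads of live nodes are blocked. -/
inductive Step {Val : Type u} {n : ℕ} (f : ℕ) (D : ℝ) : Config Val n → Config Val n → Prop where
  /-- an idle client thread invokes an operation, which sends `readTag` to all -/
  | invoke (c : Config Val n) (i : Fin n) (op : Op Val) (order : Equiv.Perm (Fin n))
      (cut : Option ℕ) (hi : i ∉ c.crashed) (hidle : (c.state i).pc = .idle) :
      Step f D c (c.perform i ((c.state i).newRequest (.readWait op))
        [.toAll (.readTag ((c.state i).req + 1))] order cut)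
  /-- a client thread takes a step -/
  | client (c : Config Val n) (i : Fin n) (s' : NodeState Val n) (out : List (Send Val n))
      (order : Equiv.Perm (Fin n)) (cut : Option ℕ) (hi : i ∉ c.crashed)
      (h : ClientStep f i (c.state i) s' out) :
      Step f D c (c.perform i s' out order cut)
  /-- node `i` receives and handles the oldest message of the channel from `j`. It does not do so
  while its client thread is about to leave the wait for the equivalence quorum, since that
  wait ends with the vector that satisfies the predicate for the first time. -/
  | deliver (c : Config Val n) (j i : Fin n) (m : Msg Val n) (t : ℝ)
      (rest : List (Msg Val n × ℝ)) (order : Equiv.Perm (Fin n)) (cut : Option ℕ)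
      (hi : i ∉ c.crashed) (hEQ : ¬ EQReady f i (c.state i))
      (hm : c.chan j i = (m, t) :: rest) :
      Step f D c
        (Config.perform
          { c with chan := Function.update c.chan j (Function.update (c.chan j) i rest) }
          i (handle i j m (c.state i)).1 (handle i j m (c.state i)).2 order cut)
  /-- a node crashes between two of its steps -/
  | crash (c : Config Val n) (i : Fin n) (hi : i ∉ c.crashed) :
      Step f D c { c with crashed := insert i c.crashed }
  /-- time passes; no message to a live node stays undelivered for longer than `D` -/
  | elapse (c : Config Val n) (δ : ℝ) (hδ : 0 ≤ δ)
      (hlocal : ∀ i, i ∉ c.crashed → ∀ s' out, ¬ ClientStep f i (c.state i) s' out)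
      (hdelay : ∀ i j, j ∉ c.crashed → ∀ p ∈ c.chan i j, c.now + δ ≤ p.2 + D) :
      Step f D c { c with now := c.now + δ }

/-- An execution of AC-ASO on `n` nodes with at most `f` crashes and with message delay at
most `D`. -/
structure Execution (Val : Type u) (n f : ℕ) (D : ℝ) where
  cfg : ℕ → Config Val n
  init : cfg 0 = Config.init Val n
  step : ∀ m, Step f D (cfg m) (cfg (m + 1))
  time_unbounded : ∀ B : ℝ, ∃ m, B ≤ (cfg m).now
  crashes_le : {i | ∃ m, i ∈ (cfg m).crashed}.ncard ≤ f

namespace Execution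

variable {Val : Type u} {n f : ℕ} {D : ℝ}

/-- The number `k` of nodes that actually crash in the execution. -/
noncomputable def crashes (e : Execution Val n f D) : ℕ :=
  {i | ∃ m, i ∈ (e.cfg m).crashed}.ncard

/-- The time of the `m`-th configuration. -/
def time (e : Execution Val n f D) (m : ℕ) : ℝ := (e.cfg m).now

/-- The program counter of node `i` in the `m`-th configuration. -/
def pc (e : Execution Val n f D) (i : Fin n) (m : ℕ) : PC Val n := ((e.cfg m).state i).pc

/-- Node `i` crashes no later than at time `t`. -/
def CrashedBy (e : Execution Val n f D) (i : Fin n) (t : ℝ) : Prop :=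
  ∃ m, i ∈ (e.cfg m).crashed ∧ e.time m ≤ t

/-- In the `m`-th step node `i` starts a lattice operation with tag `r`. -/
def LatticeStarts (e : Execution Val n f D) (i : Fin n) (op : Op Val) (ph r m : ℕ) : Prop :=
  e.pc i m = .latticeCall op ph r ∧ e.pc i (m + 1) = .writeWait op ph r

/-- The lattice operation with tag `r` that node `i` starts in the `m`-th step returns no later
than at time `t`. -/
def LatticeReturnsBy (e : Execution Val n f D) (i : Fin n) (op : Op Val) (ph r m : ℕ) (t : ℝ) :
    Prop :=
  ∃ m', m < m' ∧ e.time m' ≤ t ∧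
    (∀ p, m < p → p ≤ m' → e.pc i p = .writeWait op ph r ∨ e.pc i p = .eqWait op ph r) ∧
    (∃ res, e.pc i (m' + 1) = .latticeRet op ph r res) ∧ i ∉ (e.cfg (m' + 1)).crashed

/-- In the `m`-th step node `i` invokes the operation `op`. -/
def OpStarts (e : Execution Val n f D) (i : Fin n) (op : Op Val) (m : ℕ) : Prop :=
  e.pc i m = .idle ∧ e.pc i (m + 1) = .readWait op

/-- The operation that node `i` invokes in the `m`-th step returns no later than at time `t`. -/
def OpReturnsBy (e : Execution Val n f D) (i : Fin n) (m : ℕ) (t : ℝ) : Prop :=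
  ∃ m', m < m' ∧ e.time m' ≤ t ∧ (∀ p, m < p → p ≤ m' → e.pc i p ≠ .idle) ∧
    e.pc i (m' + 1) = .idle ∧ i ∉ (e.cfg (m' + 1)).crashed

end Execution

end ACASO

namespace ACASO

/-! Every time bound is a contradiction at a well-chosen instant. Local computation takes no time,
so in the last configuration up to a time `θ` (`LastUpTo`) all live clients are blocked, and every
message sent by `θ - D` to a node still live has been handled. If the condition that a client waits
for holds there, the client cannot still be waiting.

Lattice operations. Let one with tag `r` start at time `t`. All live nodes know `r` by `t + D`, so
every `readTag()` that ends after `T = t + 3D` returns at least `r` (`le_ackTag_of_time_lt`), and an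
`Update` continuing from it writes a tag above `r`. Thus values with tag at most `r` are written by
time `T`. Only crashes can delay such a value `x` for long: until some live node has sent it to all,
every sender has crashed while sending it, and each hop costs at most `D`. So a live node has sent
`x` to all by `T + |I(x)| D`, where `I(x)` is `interrupted x` (`exists_firstSent`). After `2D` more,
every live node holds `x` from every live node. Hence if the quorum is missing at `θ`, some `x` was
first sent completely during `(θ - 2D, θ]` (`exists_spreading`).

Let `k` be the number of crashes and `a = ⌈√k⌉`. Test `a + 1` instants, `2D` apart, beginning at `T
+ (a + 2) D` (`exists_EQ`). If all tests fail, they yield `a + 1` distinct values with `|I(x)| ≥ a +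
1`. A node crashes once, in a step that sends at most one value, so the sets `I(x)` are disjoint and
`(a + 1)² ≤ k ≤ a²`, which is absurd. The operation therefore ends by `t + (5 + 3a) D`.

Operations. `readTag()` takes `2D`, at most four lattice operations follow, and then possibly a wait
for `goodLA` with tag `r`. That wait takes at most `D`: the failed operation saw a tag above `r`,
and such a tag can first come into use only after an initial lattice operation with tag `r` was good
and was announced to all (`goodSent_or_tagsLE`). -/

variable {Val : Type*} {n f : ℕ} {D : ℝ}

/-! ### Steps of the system from the point of view of one node -/

/-- An atomic step of node `i` as seen locally: the state before and after it, the send commands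
it executes, and the message it consumes together with the sender of that message. -/
inductive Event (f : ℕ) (i : Fin n) (s : NodeState Val n) :
    NodeState Val n → List (Send Val n) → Option (Fin n × Msg Val n) → Prop where
  | invoke (op : Op Val) (hidle : s.pc = .idle) :
      Event f i s (s.newRequest (.readWait op)) [.toAll (.readTag (s.req + 1))] none
  | client {s' : NodeState Val n} {out : List (Send Val n)} (h : ClientStep f i s s' out) :
      Event f i s s' out none
  | deliver (j : Fin n) (m : Msg Val n) :
      Event f i s (handle i j m s).1 (handle i j m s).2 (some (j, m))

/-- The send commands `out` put a copy of `m` into the channel to `b`. -/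
def Emits (out : List (Send Val n)) (b : Fin n) (m : Msg Val n) : Prop :=
  .toAll m ∈ out ∨ .to b m ∈ out

/-- The step from `c` to `c'` is an atomic step of node `i`, which possibly crashes in it. -/
structure Acts (f : ℕ) (c c' : Config Val n) (i : Fin n) (s' : NodeState Val n)
    (out : List (Send Val n)) (recv : Option (Fin n × Msg Val n)) : Prop where
  live : i ∉ c.crashed
  event : Event f i (c.state i) s' out recv
  state : c'.state = Function.update c.state i s'
  now : c'.now = c.now
  crashed_mono : c.crashed ⊆ c'.crashed
  crashed_le : c'.crashed ⊆ insert i c.crashed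
  chan_new : ∀ a b μ, μ ∈ c'.chan a b →
    μ ∈ c.chan a b ∨ (a = i ∧ μ.2 = c.now ∧ Emits out b μ.1)
  chan_keep : ∀ a b μ, μ ∈ c.chan a b → μ ∈ c'.chan a b ∨ (b = i ∧ recv = some (a, μ.1))
  chan_sent : i ∉ c'.crashed → ∀ b m, Emits out b m → (m, c.now) ∈ c'.chan i b
  recv_mem : ∀ j m, recv = some (j, m) → ∃ τ, (m, τ) ∈ c.chan j i

/-- The step from `c` to `c'` is a crash between two atomic steps or a passage of time. -/
structure Quiet (f : ℕ) (D : ℝ) (c c' : Config Val n) : Prop where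
  state : c'.state = c.state
  chan : c'.chan = c.chan
  crashed_mono : c.crashed ⊆ c'.crashed
  now_le : c.now ≤ c'.now
  elapse : c'.now = c.now ∨ ((∀ i, i ∉ c.crashed → ∀ s' out, ¬ ClientStep f i (c.state i) s' out) ∧
    (∀ i j, j ∉ c.crashed → ∀ p ∈ c.chan i j, c'.now ≤ p.2 + D) ∧ c'.crashed = c.crashed)

theorem mem_packets (order : Equiv.Perm (Fin n)) (out : List (Send Val n)) (b : Fin n)
    (m : Msg Val n) : (b, m) ∈ packets order out ↔ Emits out b m := by
  unfold packets Emits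
  rw [List.mem_flatMap]
  constructor
  · rintro ⟨m' | ⟨j, m'⟩, hc, h⟩
    · simp only [List.mem_map, Prod.mk.injEq] at h
      obtain ⟨_, _, _, rfl⟩ := h
      exact .inl hc
    · simp only [List.mem_singleton, Prod.mk.injEq] at h
      obtain ⟨rfl, rfl⟩ := h
      exact .inr hc
  · rintro (h | h)
    · refine ⟨_, h, ?_⟩
      simp only [List.mem_map, Prod.mk.injEq]
      exact ⟨order.symm b, List.mem_finRange _, by simp, trivial⟩
    · exact ⟨_, h, by simp⟩

theorem mem_post (c : Config Val n) (i a b : Fin n) (ps : List (Fin n × Msg Val n))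
    (μ : Msg Val n × ℝ) : μ ∈ (c.post i ps).chan a b ↔
      μ ∈ c.chan a b ∨ (a = i ∧ μ.2 = c.now ∧ (b, μ.1) ∈ ps) := by
  obtain ⟨m, τ⟩ := μ
  unfold Config.post
  by_cases h : a = i
  · subst h
    simp only [Function.update_self, List.mem_append, List.mem_map, List.mem_filter,
      decide_eq_true_eq, Prod.mk.injEq, true_and]
    refine or_congr_right ⟨?_, ?_⟩
    · rintro ⟨⟨b', m'⟩, ⟨h1, rfl⟩, rfl, rfl⟩
      exact ⟨rfl, h1⟩
    · rintro ⟨rfl, h1⟩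
      exact ⟨(b, m), ⟨h1, rfl⟩, rfl, rfl⟩
  · simp [h]

theorem acts_perform {c₀ c : Config Val n} {i : Fin n} {s' : NodeState Val n}
    {out : List (Send Val n)} {recv : Option (Fin n × Msg Val n)} (order : Equiv.Perm (Fin n))
    (cut : Option ℕ) (live : i ∉ c₀.crashed) (event : Event f i (c₀.state i) s' out recv)
    (hs : c.state = c₀.state) (hn : c.now = c₀.now) (hc : c.crashed = c₀.crashed)
    (hnew : ∀ a b μ, μ ∈ c.chan a b → μ ∈ c₀.chan a b)
    (hkeep : ∀ a b μ, μ ∈ c₀.chan a b → μ ∈ c.chan a b ∨ (b = i ∧ recv = some (a, μ.1)))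
    (hrecv : ∀ j m, recv = some (j, m) → ∃ τ, (m, τ) ∈ c₀.chan j i) :
    Acts f c₀ (c.perform i s' out order cut) i s' out recv where
  live := live
  event := event
  state := by cases cut <;> simp [Config.perform, Config.post, hs]
  now := by cases cut <;> simp [Config.perform, Config.post, hn]
  crashed_mono := by cases cut <;> simp [Config.perform, Config.post, hc]
  crashed_le := by cases cut <;> simp [Config.perform, Config.post, hc]
  chan_new a b μ h := by
    cases cut with
    | none =>
      have h : μ ∈ (c.post i (packets order out)).chan a b := h
      rw [mem_post, mem_packets, hn] at h
      exact h.imp_left (hnew a b μ)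
    | some l =>
      have h : μ ∈ (c.post i ((packets order out).take l)).chan a b := h
      rw [mem_post, hn] at h
      refine h.imp (hnew a b μ) fun h => ⟨h.1, h.2.1, ?_⟩
      rw [← mem_packets order]
      exact List.mem_of_mem_take h.2.2
  chan_keep a b μ h := by
    refine (hkeep a b μ h).imp_left fun h => ?_
    cases cut with
    | none => exact (mem_post c i a b (packets order out) μ).2 (.inl h)
    | some l => exact (mem_post c i a b ((packets order out).take l) μ).2 (.inl h)
  chan_sent h b m hm := by
    cases cut with
    | none =>
      exact (mem_post c i i b (packets order out) (m, c₀.now)).2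
        (.inr ⟨rfl, hn.symm, (mem_packets order out b m).2 hm⟩)
    | some l => exact absurd (Set.mem_insert i _) h
  recv_mem := hrecv

/-- Reduces all later case analyses to two cases. Channels are kept only as sets of messages with
sending times, which is all that the time bounds need. -/
theorem Step.acts_or_quiet {c c' : Config Val n} (h : Step f D c c') :
    (∃ i s' out recv, Acts f c c' i s' out recv) ∨ Quiet f D c c' := by
  cases h with
  | invoke i op order cut hi hidle =>
    exact .inl ⟨i, _, _, none, acts_perform order cut hi (.invoke op hidle) rfl rfl rfl
      (fun _ _ _ h => h) (fun _ _ _ h => .inl h) (by simp)⟩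
  | client i s' out order cut hi h =>
    exact .inl ⟨i, _, _, none, acts_perform order cut hi (.client h) rfl rfl rfl
      (fun _ _ _ h => h) (fun _ _ _ h => .inl h) (by simp)⟩
  | deliver j i m t rest order cut hi hEQ hm =>
    refine .inl ⟨i, _, _, some (j, m), acts_perform order cut hi (.deliver j m) rfl rfl rfl ?_ ?_ ?_⟩
    · intro a b μ h
      by_cases ha : a = j
      · subst ha
        by_cases hb : b = i
        · subst hb
          rw [hm]
          simp only [Function.update_self] at h
          exact List.mem_cons_of_mem _ h
        · simpa [Function.update_of_ne hb] using h
      · simpa [Function.update_of_ne ha] using h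
    · intro a b μ h
      by_cases ha : a = j
      · subst ha
        by_cases hb : b = i
        · subst hb
          rw [hm] at h
          simp only [Function.update_self]
          rcases List.mem_cons.1 h with rfl | h
          · exact .inr ⟨trivial, rfl⟩
          · exact .inl h
        · exact .inl (by simpa [Function.update_of_ne hb] using h)
      · exact .inl (by simpa [Function.update_of_ne ha] using h)
    · rintro j' m' h
      obtain ⟨rfl, rfl⟩ : j = j' ∧ m = m' := by simpa using h
      exact ⟨t, by rw [hm]; exact List.mem_cons_self⟩
  | crash i hi => exact .inr ⟨rfl, rfl, Set.subset_insert _ _, le_rfl, Or.inl rfl⟩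
  | elapse δ hδ hlocal hdelay =>
    exact .inr ⟨rfl, rfl, subset_rfl, le_add_of_nonneg_right hδ, .inr ⟨hlocal, hdelay, rfl⟩⟩

/-! ## Monotonicity of the local state -/

section Event

variable {i : Fin n} {s s' : NodeState Val n} {out : List (Send Val n)}
  {recv : Option (Fin n × Msg Val n)}

theorem Event.mono (h : Event f i s s' out recv) :
    s.sent ⊆ s'.sent ∧ s.maxTag ≤ s'.maxTag ∧ (∀ j, s.V j ⊆ s'.V j) ∧ s.goodLAs ⊆ s'.goodLAs ∧
      s.req ≤ s'.req ∧ (s'.req = s.req → s.acks ⊆ s'.acks) := by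
  cases h with
  | invoke => simp [NodeState.newRequest]
  | client h =>
    cases h
    case direct op _ _ _ _ _ => cases op <;> simp [NodeState.finish]
    case indirect op _ _ _ _ => cases op <;> simp [NodeState.finish]
    all_goals simp [NodeState.newRequest]
  | deliver j m =>
    cases m <;> simp only [handle] <;> try split_ifs
    all_goals simp
    intro l
    split_ifs
    · exact Set.subset_insert _ _
    · rfl

end Event

theorem Acts.state_self {c c' : Config Val n} {i : Fin n} {s' : NodeState Val n}
    {out : List (Send Val n)} {recv : Option (Fin n × Msg Val n)} (h : Acts f c c' i s' out recv) :
    c'.state i = s' := by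
  rw [h.state, Function.update_self]

theorem Acts.state_ne {c c' : Config Val n} {i j : Fin n} {s' : NodeState Val n}
    {out : List (Send Val n)} {recv : Option (Fin n × Msg Val n)} (h : Acts f c c' i s' out recv)
    (hj : j ≠ i) : c'.state j = c.state j := by
  rw [h.state, Function.update_of_ne hj]

theorem Step.mono {c c' : Config Val n} (h : Step f D c c') (j : Fin n) :
    (c.state j).sent ⊆ (c'.state j).sent ∧ (c.state j).maxTag ≤ (c'.state j).maxTag ∧
      (∀ l, (c.state j).V l ⊆ (c'.state j).V l) ∧ (c.state j).goodLAs ⊆ (c'.state j).goodLAs ∧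
      (c.state j).req ≤ (c'.state j).req ∧
      ((c'.state j).req = (c.state j).req → (c.state j).acks ⊆ (c'.state j).acks) := by
  rcases h.acts_or_quiet with ⟨i, s', out, recv, h⟩ | h
  · by_cases hj : j = i
    · subst hj
      rw [h.state_self]
      exact h.event.mono
    · rw [h.state_ne hj]
      simp
  · rw [h.state]
    simp

theorem Step.crashed_mono {c c' : Config Val n} (h : Step f D c c') : c.crashed ⊆ c'.crashed := by
  rcases h.acts_or_quiet with ⟨i, s', out, recv, h⟩ | h <;> exact h.crashed_mono

theorem Step.now_mono {c c' : Config Val n} (h : Step f D c c') : c.now ≤ c'.now := by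
  rcases h.acts_or_quiet with ⟨i, s', out, recv, h⟩ | h
  · exact h.now.ge
  · exact h.now_le

/-! ### Induction along an execution and global monotonicity -/

namespace Execution

variable (e : Execution Val n f D)

/-- Induction over the configurations of an execution, starting from the `a`-th one. -/
theorem induction_from {P : Config Val n → Prop} {a : ℕ} (h0 : P (e.cfg a))
    (hq : ∀ p, a ≤ p → Quiet f D (e.cfg p) (e.cfg (p + 1)) → P (e.cfg p) → P (e.cfg (p + 1)))
    (ha : ∀ p, a ≤ p → ∀ i s' out recv, Acts f (e.cfg p) (e.cfg (p + 1)) i s' out recv →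
      P (e.cfg p) → P (e.cfg (p + 1))) {p : ℕ} (hp : a ≤ p) : P (e.cfg p) := by
  induction p, hp using Nat.le_induction with
  | base => exact h0
  | succ p hp ih =>
    rcases (e.step p).acts_or_quiet with ⟨i, s', out, recv, h⟩ | h
    · exact ha p hp i s' out recv h ih
    · exact hq p hp h ih

/-- Induction over the configurations of an execution. -/
theorem invariant {P : Config Val n → Prop} (h0 : P (Config.init Val n))
    (hq : ∀ p, Quiet f D (e.cfg p) (e.cfg (p + 1)) → P (e.cfg p) → P (e.cfg (p + 1)))
    (ha : ∀ p, ∀ i s' out recv, Acts f (e.cfg p) (e.cfg (p + 1)) i s' out recv →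
      P (e.cfg p) → P (e.cfg (p + 1))) (p : ℕ) : P (e.cfg p) :=
  e.induction_from (a := 0) (e.init ▸ h0) (fun p _ => hq p) (fun p _ => ha p) (Nat.zero_le p)

theorem time_mono : Monotone e.time := monotone_nat_of_le_succ fun p => (e.step p).now_mono

theorem crashed_mono : Monotone fun p => (e.cfg p).crashed :=
  monotone_nat_of_le_succ fun p => (e.step p).crashed_mono

theorem not_crashed_of_le {i : Fin n} {p q : ℕ} (h : p ≤ q) (hq : i ∉ (e.cfg q).crashed) :
    i ∉ (e.cfg p).crashed := fun hp => hq (e.crashed_mono h hp)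

theorem sent_mono (j : Fin n) : Monotone fun p => ((e.cfg p).state j).sent :=
  monotone_nat_of_le_succ fun p => ((e.step p).mono j).1

theorem maxTag_mono (j : Fin n) : Monotone fun p => ((e.cfg p).state j).maxTag :=
  monotone_nat_of_le_succ fun p => ((e.step p).mono j).2.1

theorem V_mono (j l : Fin n) : Monotone fun p => ((e.cfg p).state j).V l :=
  monotone_nat_of_le_succ fun p => ((e.step p).mono j).2.2.1 l

theorem goodLAs_mono (j : Fin n) : Monotone fun p => ((e.cfg p).state j).goodLAs :=
  monotone_nat_of_le_succ fun p => ((e.step p).mono j).2.2.2.1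

theorem req_mono (j : Fin n) : Monotone fun p => ((e.cfg p).state j).req :=
  monotone_nat_of_le_succ fun p => ((e.step p).mono j).2.2.2.2.1

theorem acks_mono {j : Fin n} {p q : ℕ} (hpq : p ≤ q)
    (h : ((e.cfg q).state j).req = ((e.cfg p).state j).req) :
    ((e.cfg p).state j).acks ⊆ ((e.cfg q).state j).acks := by
  induction q, hpq using Nat.le_induction with
  | base => rfl
  | succ q hq ih =>
    have h1 := e.req_mono j hq
    have h2 := ((e.step q).mono j).2.2.2.2.1
    have h3 := ((e.step q).mono j).2.2.2.2.2
    simp only at h1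
    exact (ih (by omega)).trans (h3 (by omega))

/-! ## Timely delivery -/

theorem sent_le_now (p : ℕ) : ∀ i j, ∀ μ ∈ (e.cfg p).chan i j, μ.2 ≤ (e.cfg p).now := by
  refine e.invariant (P := fun c => ∀ i j, ∀ μ ∈ c.chan i j, μ.2 ≤ c.now) ?_ ?_ ?_ p
  · simp [Config.init]
  · intro p h ih i j μ hμ
    rw [h.chan] at hμ
    exact (ih i j μ hμ).trans h.now_le
  · intro p i s' out recv h ih a b μ hμ
    rw [h.now]
    rcases h.chan_new a b μ hμ with h1 | h1
    · exact ih a b μ h1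
    · exact h1.2.1.le

theorem now_le_deadline (hD : 0 < D) (p : ℕ) : ∀ i j, j ∉ (e.cfg p).crashed →
    ∀ μ ∈ (e.cfg p).chan i j, (e.cfg p).now ≤ μ.2 + D := by
  refine e.invariant (P := fun c => ∀ i j, j ∉ c.crashed → ∀ μ ∈ c.chan i j, c.now ≤ μ.2 + D)
    ?_ ?_ ?_ p
  · simp [Config.init]
  · intro p h ih i j hj μ hμ
    have hj' := fun h' => hj (h.crashed_mono h')
    rw [h.chan] at hμ
    rcases h.elapse with h1 | ⟨_, h1, _⟩
    · rw [h1]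
      exact ih i j hj' μ hμ
    · exact h1 i j hj' μ hμ
  · intro p i s' out recv h ih a b hb μ hμ
    rw [h.now]
    rcases h.chan_new a b μ hμ with h1 | h1
    · exact ih a b (fun h' => hb (h.crashed_mono h')) μ h1
    · linarith [h1.2.1]

/-- The `p`-th configuration is the last one at a time up to `θ`. -/
structure LastUpTo (θ : ℝ) (p : ℕ) : Prop where
  time_le : e.time p ≤ θ
  blocked : ∀ i, i ∉ (e.cfg p).crashed → ∀ s' out, ¬ ClientStep f i ((e.cfg p).state i) s' out
  recent : ∀ i j, j ∉ (e.cfg p).crashed → ∀ μ ∈ (e.cfg p).chan i j, θ < μ.2 + D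
  lt_time : θ < e.time (p + 1)
  state_succ : (e.cfg (p + 1)).state = (e.cfg p).state

/-- The step into the first configuration later than `θ` strictly increases the time, so it is a
passage of time; its side conditions are the properties wanted just before it. -/
theorem exists_lastUpTo {θ : ℝ} (hθ : 0 ≤ θ) : ∃ p, e.LastUpTo θ p := by
  classical
  obtain ⟨m, hm⟩ := e.time_unbounded (θ + 1)
  have hex : ∃ m, θ < e.time m := ⟨m, by unfold time; linarith⟩
  obtain ⟨p, hp⟩ : ∃ p, Nat.find hex = p + 1 := by
    refine Nat.exists_eq_succ_of_ne_zero fun h0 => ?_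
    have := Nat.find_spec hex
    rw [h0, time, e.init] at this
    exact absurd this (not_lt.2 hθ)
  have h1 : θ < e.time (p + 1) := hp ▸ Nat.find_spec hex
  have h2 : e.time p ≤ θ := not_lt.1 (Nat.find_min hex (by omega))
  rcases (e.step p).acts_or_quiet with ⟨i, s', out, recv, h⟩ | h
  · have := h.now
    unfold time at h1 h2
    linarith
  · rcases h.elapse with h3 | ⟨h3, h4, h5⟩
    · unfold time at h1 h2
      linarith
    · exact ⟨p, h2, h3, fun i j hj μ hμ => lt_of_lt_of_le h1 (h4 i j hj μ hμ), h1, h.state⟩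

variable {e}

theorem LastUpTo.le_of_time_le {θ : ℝ} {p q : ℕ} (h : e.LastUpTo θ p) (hq : e.time q ≤ θ) :
    q ≤ p := by
  by_contra! hc
  exact absurd (e.time_mono (show p + 1 ≤ q from hc)) (not_le.2 (hq.trans_lt h.lt_time))

theorem LastUpTo.mono {θ θ' : ℝ} {p q : ℕ} (hp : e.LastUpTo θ p) (hq : e.LastUpTo θ' q)
    (h : θ ≤ θ') : p ≤ q :=
  hq.le_of_time_le (hp.time_le.trans h)

variable (e)

/-- In the `b`-th step node `l` handles the message `m` from `j`. -/
structure Handles (b : ℕ) (j l : Fin n) (m : Msg Val n) : Prop where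
  state : (e.cfg (b + 1)).state l = (handle l j m ((e.cfg b).state l)).1
  sends : l ∉ (e.cfg (b + 1)).crashed → ∀ a m', Emits (handle l j m ((e.cfg b).state l)).2 a m' →
    (m', e.time b) ∈ (e.cfg (b + 1)).chan l a

theorem mem_chan_or_handles {a p : ℕ} (hap : a ≤ p) {j l : Fin n} {m : Msg Val n} {τ : ℝ}
    (h : (m, τ) ∈ (e.cfg a).chan j l) :
    (m, τ) ∈ (e.cfg p).chan j l ∨ ∃ b, a ≤ b ∧ b < p ∧ e.Handles b j l m := by
  induction p, hap using Nat.le_induction with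
  | base => exact .inl h
  | succ p hp ih =>
    rcases ih with ih | ⟨b, h1, h2, h3⟩
    · rcases (e.step p).acts_or_quiet with ⟨i, s', out, recv, hA⟩ | hQ
      · rcases hA.chan_keep j l _ ih with h1 | ⟨rfl, rfl⟩
        · exact .inl h1
        · refine .inr ⟨p, hp, by omega, ?_⟩
          have hev := hA.event
          cases hev
          exact ⟨hA.state_self, fun hc a m' hm' => hA.chan_sent hc a m' hm'⟩
      · exact .inl (by rw [hQ.chan]; exact ih)
    · exact .inr ⟨b, h1, by omega, h3⟩

theorem handles_of_mem {θ : ℝ} {a p : ℕ} (hp : e.LastUpTo θ p) {j l : Fin n}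
    (hl : l ∉ (e.cfg p).crashed) {m : Msg Val n} {τ : ℝ} (hτ : τ + D ≤ θ) (hap : a ≤ p)
    (h : (m, τ) ∈ (e.cfg a).chan j l) : ∃ b, a ≤ b ∧ b < p ∧ e.Handles b j l m := by
  refine (e.mem_chan_or_handles hap h).resolve_left fun h1 => ?_
  have := hp.recent j l hl _ h1
  simp only at this
  linarith

end Execution

/-! ## Local effects of an atomic step -/

@[simp]
theorem emits_nil (b : Fin n) (m : Msg Val n) : ¬ Emits [] b m := by simp [Emits]

@[simp]
theorem emits_toAll (b : Fin n) (m m' : Msg Val n) : Emits [.toAll m'] b m ↔ m = m' := by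
  simp [Emits]

@[simp]
theorem handle_pc (i j : Fin n) (m : Msg Val n) (s : NodeState Val n) :
    (handle i j m s).1.pc = s.pc := by
  cases m <;> simp only [handle] <;> split_ifs <;> rfl

@[simp]
theorem handle_req (i j : Fin n) (m : Msg Val n) (s : NodeState Val n) :
    (handle i j m s).1.req = s.req := by
  cases m <;> simp only [handle] <;> split_ifs <;> rfl

@[simp]
theorem finish_pc (s : NodeState Val n) (op : Op Val) (v : View Val n) :
    (s.finish op v).pc = .idle := by
  cases op <;> rfl

@[simp]
theorem finish_maxTag (s : NodeState Val n) (op : Op Val) (v : View Val n) :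
    (s.finish op v).maxTag = s.maxTag := by
  cases op <;> rfl

@[simp]
theorem finish_ackTag (s : NodeState Val n) (op : Op Val) (v : View Val n) :
    (s.finish op v).ackTag = s.ackTag := by
  cases op <;> rfl

@[simp]
theorem finish_sent (s : NodeState Val n) (op : Op Val) (v : View Val n) :
    (s.finish op v).sent = s.sent := by
  cases op <;> rfl

@[simp]
theorem finish_V (s : NodeState Val n) (op : Op Val) (v : View Val n) :
    (s.finish op v).V = s.V := by
  cases op <;> rfl

/-- The value `x` is the one that node `i` in state `s` writes when its `readTag()` returns. -/
def Writes (f : ℕ) (i : Fin n) (s : NodeState Val n) (x : Value Val n) : Prop :=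
  ∃ v, s.pc = .readWait (.update v) ∧ n - f ≤ s.acks.card ∧ x = ⟨v, s.ackTag + 1, i⟩

/-- `m` is a `readTag` or `writeTag` request with number `q`. -/
def IsRequest (q : ℕ) (m : Msg Val n) : Prop :=
  m = .readTag q ∨ ∃ t, m = .writeTag t q

/-- `m` is an acknowledgement of the request with number `q`. -/
def IsAck (q : ℕ) (m : Msg Val n) : Prop :=
  ∃ t, m = .readAck t q ∨ m = .writeAck t q

/-- The client thread waits for acknowledgements. -/
def PC.Waiting (pc : PC Val n) : Prop :=
  (∃ op, pc = .readWait op) ∨ ∃ op ph r, pc = .writeWait op ph r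

/-- The client thread is in a lattice operation with tag `r`, after its start. -/
def PC.InLattice (pc : PC Val n) (op : Op Val) (ph r : ℕ) : Prop :=
  pc = .writeWait op ph r ∨ pc = .eqWait op ph r

section Event

variable {i : Fin n} {s s' : NodeState Val n} {out : List (Send Val n)}
  {recv : Option (Fin n × Msg Val n)}

theorem Event.emits_value (h : Event f i s s' out recv) {b : Fin n} {x : Value Val n}
    (hm : Emits out b (.value x)) :
    x ∈ s'.sent ∧ (Writes f i s x ∨ (∃ j, recv = some (j, .value x)) ∧ x ∉ s.sent) := by
  cases h with
  | invoke => simp at hm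
  | client h =>
    cases h
    case readDoneUpdate v h hq =>
      simp only [emits_toAll, Msg.value.injEq] at hm
      subst hm
      exact ⟨Set.mem_insert _ _, .inl ⟨v, h, hq, rfl⟩⟩
    all_goals simp at hm
  | deliver j m =>
    cases m <;> simp only [handle] at hm ⊢
    case value y =>
      split_ifs at hm with hy
      · simp at hm
      · simp only [emits_toAll, Msg.value.injEq] at hm
        subst hm
        exact ⟨Set.mem_insert _ _, .inr ⟨⟨j, rfl⟩, hy⟩⟩
    all_goals simp [Emits] at hm

theorem Event.mem_sent (h : Event f i s s' out recv) {x : Value Val n} (hx : x ∈ s'.sent)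
    (hx' : x ∉ s.sent) : (∀ b, Emits out b (.value x)) ∧
      (Writes f i s x ∨ ∃ j, recv = some (j, .value x)) := by
  cases h with
  | invoke => exact absurd hx hx'
  | client h =>
    cases h
    case readDoneUpdate v h hq =>
      obtain rfl := hx.resolve_right hx'
      exact ⟨by simp, .inl ⟨v, h, hq, rfl⟩⟩
    all_goals exact absurd (by simpa [NodeState.newRequest] using hx) hx'
  | deliver j m =>
    cases m <;> simp only [handle] at hx ⊢
    case value y =>
      obtain rfl := hx.resolve_right hx'
      exact ⟨by simp [hx'], .inr ⟨j, rfl⟩⟩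
    all_goals exact absurd (by first | exact hx | (split_ifs at hx <;> exact hx)) hx'

/-- A single crash can interrupt the spreading of at most one value; the disjointness in
`disjoint_interrupted` rests on this. -/
theorem Event.sent_unique (h : Event f i s s' out recv) {x y : Value Val n} (hx : x ∈ s'.sent)
    (hx' : x ∉ s.sent) (hy : y ∈ s'.sent) (hy' : y ∉ s.sent) : x = y := by
  have h1 := (h.mem_sent hx hx').1 i
  have h2 := (h.mem_sent hy hy').1 i
  cases h with
  | invoke => simp at h1
  | client h =>
    cases h
    case readDoneUpdate v h hq =>
      simp only [emits_toAll, Msg.value.injEq] at h1 h2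
      rw [h1, h2]
    all_goals simp at h1
  | deliver j m =>
    cases m <;> simp only [handle] at h1 h2
    case value z =>
      split_ifs at h1 h2
      · simp at h1
      · simp only [emits_toAll, Msg.value.injEq] at h1 h2
        rw [h1, h2]
    all_goals simp [Emits] at h1

theorem Event.mem_V (h : Event f i s s' out recv) {x : Value Val n} {j : Fin n} (hx : x ∈ s'.V j)
    (hx' : x ∉ s.V j) : ∃ j', recv = some (j', .value x) ∧ (j = j' ∨ j = i) := by
  cases h with
  | invoke => exact absurd hx hx'
  | client h =>
    cases h
    all_goals exact absurd (by simpa [NodeState.newRequest] using hx) hx'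
  | deliver j' m =>
    cases m <;> simp only [handle] at hx ⊢
    case value y =>
      split_ifs at hx with hj
      · obtain rfl := hx.resolve_right hx'
        exact ⟨j', rfl, hj⟩
      · exact absurd hx hx'
    all_goals exact absurd (by first | exact hx | (split_ifs at hx <;> exact hx)) hx'

theorem handle_value_mem (i j : Fin n) (x : Value Val n) (s : NodeState Val n) :
    x ∈ (handle i j (.value x) s).1.V j ∧ x ∈ (handle i j (.value x) s).1.sent := by
  simp [handle]

theorem Event.recv_value {x : Value Val n} {j : Fin n}
    (h : Event f i s s' out (some (j, .value x))) : x ∈ s'.V j ∧ x ∈ s'.sent := by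
  cases h
  exact handle_value_mem i j x s

theorem handle_ack {i j : Fin n} {m : Msg Val n} {s : NodeState Val n} (hm : IsAck s.req m) :
    j ∈ (handle i j m s).1.acks := by
  obtain ⟨t, rfl | rfl⟩ := hm <;> simp [handle]

theorem handle_request {q : ℕ} {i j : Fin n} {m : Msg Val n} {s : NodeState Val n}
    (hm : IsRequest q m) : ∃ m', IsAck q m' ∧ Emits (handle i j m s).2 j m' := by
  obtain rfl | ⟨t, rfl⟩ := hm
  · exact ⟨.readAck s.maxTag q, ⟨_, .inl rfl⟩, by simp [handle, Emits]⟩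
  · exact ⟨.writeAck t q, ⟨_, .inr rfl⟩, by simp [handle, Emits]⟩

theorem Event.waiting (h : Event f i s s' out recv) (hw : s'.pc.Waiting) :
    (s.pc.Waiting ∧ s'.req = s.req) ∨ ∀ b, ∃ m, IsRequest s'.req m ∧ Emits out b m := by
  cases h with
  | invoke => exact .inr fun b => ⟨_, .inl rfl, by simp [NodeState.newRequest]⟩
  | client h =>
    cases h
    case latticeStart op ph r h =>
      exact .inr fun b => ⟨.writeTag r (s.req + 1), .inr ⟨r, rfl⟩, by simp⟩
    all_goals simp [PC.Waiting] at hw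
  | deliver => exact .inl (by simpa using hw)

theorem Event.emits_request (h : Event f i s s' out recv) {q : ℕ} {m : Msg Val n}
    (hq : IsRequest q m) {b : Fin n} (hm : Emits out b m) : q = s.req + 1 ∧ s'.req = s.req + 1 := by
  cases h with
  | invoke =>
    obtain rfl | ⟨t, rfl⟩ := hq <;> simp at hm
    exact ⟨hm, rfl⟩
  | client h =>
    cases h
    case latticeStart op ph r h =>
      obtain rfl | ⟨t, rfl⟩ := hq <;> simp at hm
      exact ⟨hm.2, rfl⟩
    all_goals obtain rfl | ⟨t, rfl⟩ := hq <;> simp at hm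
  | deliver j m' =>
    cases m' <;> simp only [handle] at hm <;> (try split_ifs at hm) <;>
      obtain rfl | ⟨t, rfl⟩ := hq <;> simp [Emits] at hm

theorem Event.emits_writeTag (h : Event f i s s' out recv) {t q : ℕ} {b : Fin n}
    (hm : Emits out b (.writeTag t q)) : ∃ op ph, s'.pc = .writeWait op ph t := by
  cases h with
  | invoke => simp at hm
  | client h =>
    cases h
    case latticeStart op ph r h =>
      simp only [emits_toAll, Msg.writeTag.injEq] at hm
      obtain ⟨rfl, rfl⟩ := hm
      exact ⟨op, ph, rfl⟩
    all_goals simp at hm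
  | deliver j m' =>
    cases m' <;> simp only [handle] at hm <;> (try split_ifs at hm) <;> simp [Emits] at hm

theorem Event.emits_readAck (h : Event f i s s' out recv) {t q : ℕ} {b : Fin n}
    (hm : Emits out b (.readAck t q)) : t = s.maxTag ∧ recv = some (b, .readTag q) := by
  cases h with
  | invoke => simp at hm
  | client h => cases h <;> simp at hm
  | deliver j m' =>
    cases m' <;> simp only [handle] at hm <;> (try split_ifs at hm) <;> simp [Emits] at hm
    obtain ⟨rfl, rfl, rfl⟩ := hm
    simp

theorem Event.emits_writeAck (h : Event f i s s' out recv) {t q : ℕ} {b : Fin n}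
    (hm : Emits out b (.writeAck t q)) : recv = some (b, .writeTag t q) := by
  cases h with
  | invoke => simp at hm
  | client h => cases h <;> simp at hm
  | deliver j m' =>
    cases m' <;> simp only [handle] at hm <;> (try split_ifs at hm) <;> simp [Emits] at hm
    obtain ⟨rfl, rfl, rfl⟩ := hm
    simp

theorem Event.readWait (h : Event f i s s' out recv) {op : Op Val} (hw : s'.pc = .readWait op) :
    (s.pc = .readWait op ∧ s'.req = s.req) ∨ (s'.req = s.req + 1 ∧ s'.acks = ∅) := by
  cases h with
  | invoke => exact .inr ⟨rfl, rfl⟩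
  | client h => cases h <;> simp [NodeState.newRequest] at hw
  | deliver => exact .inl (by simpa using hw)

theorem Event.inLattice (h : Event f i s s' out recv) {op : Op Val} {ph r : ℕ}
    (hw : s'.pc.InLattice op ph r) : s.pc.InLattice op ph r ∨
      (s.pc = .latticeCall op ph r ∧ s'.pc = .writeWait op ph r ∧
        ∀ b, ∃ q, Emits out b (.writeTag r q)) := by
  unfold PC.InLattice at *
  cases h with
  | invoke => simp [NodeState.newRequest] at hw
  | client h =>
    cases h <;> simp [NodeState.newRequest] at hw
    case latticeStart op ph r h =>
      obtain ⟨rfl, rfl, rfl⟩ := hw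
      exact .inr ⟨h, rfl, fun b => ⟨_, (emits_toAll _ _ _).2 rfl⟩⟩
    case writeDone op ph r h _ =>
      obtain ⟨rfl, rfl, rfl⟩ := hw
      exact .inl (.inl h)
  | deliver => exact .inl (by simpa using hw)

theorem Event.of_inLattice (h : Event f i s s' out recv) {op : Op Val} {ph r : ℕ}
    (hw : s.pc.InLattice op ph r) :
    (s'.pc.InLattice op ph r ∧ (s.pc = .eqWait op ph r → s'.pc = .eqWait op ph r) ∧
      s'.req = s.req) ∨ ∃ res, s'.pc = .latticeRet op ph r res := by
  unfold PC.InLattice at *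
  cases h with
  | invoke op h => simp [h] at hw
  | client h =>
    cases h
    case writeDone op ph r h _ =>
      simp only [h, PC.writeWait.injEq, reduceCtorEq, or_false] at hw
      obtain ⟨rfl, rfl, rfl⟩ := hw
      exact .inl ⟨.inr rfl, fun _ => rfl, rfl⟩
    case latticeGood op ph r h _ _ =>
      simp only [h, PC.eqWait.injEq, reduceCtorEq, false_or] at hw
      obtain ⟨rfl, rfl, rfl⟩ := hw
      exact .inr ⟨_, rfl⟩
    case latticeBad op ph r h _ _ =>
      simp only [h, PC.eqWait.injEq, reduceCtorEq, false_or] at hw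
      obtain ⟨rfl, rfl, rfl⟩ := hw
      exact .inr ⟨_, rfl⟩
    all_goals simp_all
  | deliver => exact .inl (by simpa using hw)

end Event

/-! ## Invariants -/

/-- Where the values are: what has been received has been sent, and what a live node has sent is
on its way to everyone or has been received. -/
structure ValueInv (c : Config Val n) : Prop where
  chan_sent : ∀ j l x τ, (.value x, τ) ∈ c.chan j l → x ∈ (c.state j).sent
  V_sent : ∀ i j, (c.state i).V j ⊆ (c.state j).sent
  V_forwarded : ∀ i j, (c.state i).V j ⊆ (c.state i).sent
  delivered : ∀ j, j ∉ c.crashed → ∀ x ∈ (c.state j).sent, ∀ l,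
    (∃ τ, (.value x, τ) ∈ c.chan j l) ∨ x ∈ (c.state l).V j

/-- Every request of a live node is on its way, answered by a message on its way, acknowledged, or
lost because of a crash. -/
def RequestInv (c : Config Val n) : Prop :=
  ∀ w, w ∉ c.crashed → (c.state w).pc.Waiting → ∀ l,
    l ∈ c.crashed ∨ l ∈ (c.state w).acks ∨
    (∃ m τ, IsRequest (c.state w).req m ∧ (m, τ) ∈ c.chan w l) ∨
    (∃ m τ, IsAck (c.state w).req m ∧ (m, τ) ∈ c.chan l w)

/-- The tag of a lattice operation of a live node is on its way to everyone or has arrived. -/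
def WriteTagInv (c : Config Val n) : Prop :=
  ∀ w, w ∉ c.crashed → ∀ op ph r, (c.state w).pc.InLattice op ph r → ∀ l,
    l ∈ c.crashed ∨ r ≤ (c.state l).maxTag ∨ ∃ q τ, (.writeTag r q, τ) ∈ c.chan w l

/-- Requests and acknowledgements carry numbers of requests that have been made, and while a node
is in `readTag()`, no `writeTag` message carries the current number. -/
structure NumberInv (c : Config Val n) : Prop where
  request : ∀ w l m τ q, IsRequest q m → (m, τ) ∈ c.chan w l → q ≤ (c.state w).req
  ack : ∀ w l m τ q, IsAck q m → (m, τ) ∈ c.chan l w → q ≤ (c.state w).req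
  writeTag : ∀ w l t τ q, (.writeTag t q, τ) ∈ c.chan w l → ∀ op, (c.state w).pc = .readWait op →
    q < (c.state w).req
  writeAck : ∀ w l t τ q, (.writeAck t q, τ) ∈ c.chan l w → ∀ op, (c.state w).pc = .readWait op →
    q < (c.state w).req

/-! ### Preservation of the invariants by atomic steps -/

section Acts

variable {c c' : Config Val n} {i : Fin n} {s' : NodeState Val n} {out : List (Send Val n)}
  {recv : Option (Fin n × Msg Val n)}

theorem ValueInv.acts (h : Acts f c c' i s' out recv) (hc : ValueInv c) : ValueInv c' := by
  have sent_mono : ∀ j, (c.state j).sent ⊆ (c'.state j).sent := by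
    intro j
    by_cases hj : j = i
    · subst hj; rw [h.state_self]; exact h.event.mono.1
    · rw [h.state_ne hj]
  have V_mono : ∀ j l, (c.state j).V l ⊆ (c'.state j).V l := by
    intro j l
    by_cases hj : j = i
    · subst hj; rw [h.state_self]; exact h.event.mono.2.2.1 l
    · rw [h.state_ne hj]
  have hV : ∀ a j x, x ∈ (c'.state a).V j → x ∉ (c.state a).V j →
      a = i ∧ ∃ j', recv = some (j', .value x) ∧ (j = j' ∨ j = i) := by
    intro a j x hx hx'
    by_cases ha : a = i
    · subst ha
      rw [h.state_self] at hx
      exact ⟨rfl, h.event.mem_V hx hx'⟩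
    · rw [h.state_ne ha] at hx
      exact absurd hx hx'
  have hself : ∀ j x, recv = some (j, .value x) → x ∈ (c'.state i).sent ∧ x ∈ (c'.state i).V j := by
    rintro j x rfl
    rw [h.state_self]
    exact h.event.recv_value.symm
  refine ⟨?_, ?_, ?_, ?_⟩
  · intro a b x τ hx
    rcases h.chan_new _ _ _ hx with h1 | ⟨rfl, _, h1⟩
    · exact sent_mono a (hc.chan_sent _ _ _ _ h1)
    · rw [h.state_self]
      exact (h.event.emits_value h1).1
  · intro a j x hx
    by_cases hx' : x ∈ (c.state a).V j
    · exact sent_mono j (hc.V_sent a j hx')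
    · obtain ⟨rfl, j', hr, rfl | rfl⟩ := hV a j x hx hx'
      · obtain ⟨τ, hτ⟩ := h.recv_mem _ _ hr
        exact sent_mono _ (hc.chan_sent _ _ _ _ hτ)
      · exact (hself _ _ hr).1
  · intro a j x hx
    by_cases hx' : x ∈ (c.state a).V j
    · exact sent_mono a (hc.V_forwarded a j hx')
    · obtain ⟨rfl, j', hr, _⟩ := hV a j x hx hx'
      exact (hself _ _ hr).1
  · intro j hj x hx l
    by_cases hx' : x ∈ (c.state j).sent
    · rcases hc.delivered j (fun h' => hj (h.crashed_mono h')) x hx' l with ⟨τ, hτ⟩ | h1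
      · rcases h.chan_keep _ _ _ hτ with h1 | ⟨rfl, h1⟩
        · exact .inl ⟨τ, h1⟩
        · exact .inr (hself _ _ h1).2
      · exact .inr (V_mono _ _ h1)
    · by_cases hji : j = i
      · subst hji
        rw [h.state_self] at hx
        exact .inl ⟨_, h.chan_sent hj l _ ((h.event.mem_sent hx hx').1 l)⟩
      · rw [h.state_ne hji] at hx
        exact absurd hx hx'

theorem RequestInv.acts (h : Acts f c c' i s' out recv) (hc : RequestInv c) : RequestInv c' := by
  intro w hw hwait l
  have hw0 : w ∉ c.crashed := fun h' => hw (h.crashed_mono h')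
  have key : ((c.state w).pc.Waiting ∧ (c'.state w).req = (c.state w).req) ∨
      ∃ m, IsRequest (c'.state w).req m ∧ (m, c.now) ∈ c'.chan w l := by
    by_cases hwi : w = i
    · subst hwi
      rw [h.state_self] at hwait ⊢
      refine (h.event.waiting hwait).imp_right fun h1 => ?_
      obtain ⟨m, h2, h3⟩ := h1 l
      exact ⟨m, h2, h.chan_sent hw l m h3⟩
    · rw [h.state_ne hwi] at hwait ⊢
      exact .inl ⟨hwait, rfl⟩
  rcases key with ⟨hwait0, hreq⟩ | ⟨m, h1, h2⟩
  swap
  · exact .inr (.inr (.inl ⟨m, _, h1, h2⟩))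
  rw [hreq]
  rcases hc w hw0 hwait0 l with h1 | h1 | ⟨m, τ, h1, h2⟩ | ⟨m, τ, h1, h2⟩
  · exact .inl (h.crashed_mono h1)
  · refine .inr (.inl ?_)
    by_cases hwi : w = i
    · subst hwi
      rw [h.state_self] at hreq ⊢
      exact h.event.mono.2.2.2.2.2 hreq h1
    · rwa [h.state_ne hwi]
  · rcases h.chan_keep _ _ _ h2 with h3 | ⟨rfl, rfl⟩
    · exact .inr (.inr (.inl ⟨m, τ, h1, h3⟩))
    · by_cases hl : l ∈ c'.crashed
      · exact .inl hl
      · have hev := h.event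
        cases hev
        obtain ⟨m', h3, h4⟩ := handle_request (i := l) (j := w) (s := c.state l) h1
        exact .inr (.inr (.inr ⟨m', _, h3, h.chan_sent hl w m' h4⟩))
  · rcases h.chan_keep _ _ _ h2 with h3 | ⟨rfl, rfl⟩
    · exact .inr (.inr (.inr ⟨m, τ, h1, h3⟩))
    · have hev := h.event
      refine .inr (.inl ?_)
      rw [h.state_self]
      cases hev
      exact handle_ack h1

theorem handle_writeTag_maxTag (i j : Fin n) (t q : ℕ) (s : NodeState Val n) :
    t ≤ (handle i j (.writeTag t q) s).1.maxTag := by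
  simp [handle]

theorem WriteTagInv.acts (h : Acts f c c' i s' out recv) (hc : WriteTagInv c) :
    WriteTagInv c' := by
  intro w hw op ph r hin l
  have hw0 : w ∉ c.crashed := fun h' => hw (h.crashed_mono h')
  have key : (c.state w).pc.InLattice op ph r ∨ ∃ q, (.writeTag r q, c.now) ∈ c'.chan w l := by
    by_cases hwi : w = i
    · subst hwi
      rw [h.state_self] at hin
      refine (h.event.inLattice hin).imp_right fun h1 => ?_
      obtain ⟨q, h2⟩ := h1.2.2 l
      exact ⟨q, h.chan_sent hw l _ h2⟩
    · rw [h.state_ne hwi] at hin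
      exact .inl hin
  rcases key with h0 | ⟨q, h1⟩
  swap
  · exact .inr (.inr ⟨q, _, h1⟩)
  rcases hc w hw0 op ph r h0 l with h1 | h1 | ⟨q, τ, h1⟩
  · exact .inl (h.crashed_mono h1)
  · refine .inr (.inl ?_)
    by_cases hli : l = i
    · subst hli
      rw [h.state_self]
      exact h1.trans h.event.mono.2.1
    · rwa [h.state_ne hli]
  · rcases h.chan_keep _ _ _ h1 with h3 | ⟨rfl, rfl⟩
    · exact .inr (.inr ⟨q, τ, h3⟩)
    · have hev := h.event
      refine .inr (.inl ?_)
      rw [h.state_self]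
      cases hev
      exact handle_writeTag_maxTag _ _ _ _ _

theorem NumberInv.acts (h : Acts f c c' i s' out recv) (hc : NumberInv c) : NumberInv c' := by
  have req_mono : ∀ j, (c.state j).req ≤ (c'.state j).req := by
    intro j
    by_cases hj : j = i
    · subst hj; rw [h.state_self]; exact h.event.mono.2.2.2.2.1
    · rw [h.state_ne hj]
  have hread : ∀ w q, (∀ op, (c.state w).pc = .readWait op → q < (c.state w).req) →
      q ≤ (c.state w).req → ∀ op, (c'.state w).pc = .readWait op → q < (c'.state w).req := by
    intro w q h1 h2 op hop
    by_cases hj : w = i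
    · subst hj
      rw [h.state_self] at hop ⊢
      rcases h.event.readWait hop with ⟨h3, h4⟩ | ⟨h3, _⟩
      · rw [h4]; exact h1 _ h3
      -- A new request takes a fresh number, so an old message is strictly behind it.
      · omega
    · rw [h.state_ne hj] at hop ⊢
      exact h1 op hop
  refine ⟨?_, ?_, ?_, ?_⟩
  · intro w l m τ q hm hμ
    rcases h.chan_new _ _ _ hμ with h1 | ⟨rfl, _, h1⟩
    · exact (hc.request _ _ _ _ _ hm h1).trans (req_mono w)
    · rw [h.state_self]
      have := h.event.emits_request hm h1
      omega
  · intro w l m τ q hm hμ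
    rcases h.chan_new _ _ _ hμ with h1 | ⟨rfl, _, h1⟩
    · exact (hc.ack _ _ _ _ _ hm h1).trans (req_mono w)
    · refine le_trans ?_ (req_mono w)
      obtain ⟨t, rfl | rfl⟩ := hm
      · obtain ⟨τ, hτ⟩ := h.recv_mem _ _ (h.event.emits_readAck h1).2
        exact hc.request _ _ _ _ _ (.inl rfl) hτ
      · obtain ⟨τ, hτ⟩ := h.recv_mem _ _ (h.event.emits_writeAck h1)
        exact hc.request _ _ _ _ _ (.inr ⟨t, rfl⟩) hτ
  · intro w l t τ q hμ
    rcases h.chan_new _ _ _ hμ with h1 | ⟨rfl, _, h1⟩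
    · exact hread w q (hc.writeTag _ _ _ _ _ h1) (hc.request _ _ _ _ _ (.inr ⟨t, rfl⟩) h1)
    · intro op hop
      obtain ⟨_, _, h2⟩ := h.event.emits_writeTag h1
      rw [h.state_self, h2] at hop
      simp at hop
  · intro w l t τ q hμ
    rcases h.chan_new _ _ _ hμ with h1 | ⟨rfl, _, h1⟩
    · exact hread w q (hc.writeAck _ _ _ _ _ h1) (hc.ack _ _ _ _ _ ⟨t, .inr rfl⟩ h1)
    · obtain ⟨τ, hτ⟩ := h.recv_mem _ _ (h.event.emits_writeAck h1)
      exact hread w q (hc.writeTag _ _ _ _ _ hτ) (hc.request _ _ _ _ _ (.inr ⟨t, rfl⟩) hτ)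

end Acts

namespace Execution

variable (e : Execution Val n f D)

theorem valueInv (p : ℕ) : ValueInv (e.cfg p) := by
  refine e.invariant ?_ ?_ (fun p i s' out recv h => ValueInv.acts h) p
  · constructor <;> simp [Config.init, NodeState.init]
  · intro p h hc
    obtain ⟨h1, h2, h3, h4⟩ := hc
    constructor <;> rw [h.state] <;> try rw [h.chan]
    · exact h1
    · exact h2
    · exact h3
    · exact fun j hj => h4 j fun h' => hj (h.crashed_mono h')

theorem requestInv (p : ℕ) : RequestInv (e.cfg p) := by
  refine e.invariant ?_ ?_ (fun p i s' out recv h => RequestInv.acts h) p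
  · simp [RequestInv, Config.init, NodeState.init, PC.Waiting]
  · intro p h hc w hw
    rw [h.state, h.chan]
    exact fun h1 l => (hc w (fun h' => hw (h.crashed_mono h')) h1 l).imp_left fun h' =>
      h.crashed_mono h'

theorem writeTagInv (p : ℕ) : WriteTagInv (e.cfg p) := by
  refine e.invariant ?_ ?_ (fun p i s' out recv h => WriteTagInv.acts h) p
  · simp [WriteTagInv, Config.init, NodeState.init, PC.InLattice]
  · intro p h hc w hw
    rw [h.state, h.chan]
    exact fun op ph r h1 l => (hc w (fun h' => hw (h.crashed_mono h')) op ph r h1 l).imp_left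
      fun h' => h.crashed_mono h'

theorem numberInv (p : ℕ) : NumberInv (e.cfg p) := by
  refine e.invariant ?_ ?_ (fun p i s' out recv h => NumberInv.acts h) p
  · constructor <;> simp [Config.init, NodeState.init]
  · intro p h hc
    obtain ⟨h1, h2, h3, h4⟩ := hc
    constructor <;> rw [h.state, h.chan] <;> assumption

/-! ## Waiting for acknowledgements -/

open Classical in
/-- The nodes that have not crashed before the `p`-th configuration. -/
noncomputable def live (p : ℕ) : Finset (Fin n) := {j | j ∉ (e.cfg p).crashed}

theorem mem_live {p : ℕ} {j : Fin n} : j ∈ e.live p ↔ j ∉ (e.cfg p).crashed := by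
  simp [live]

theorem card_live (p : ℕ) : n - f ≤ (e.live p).card := by
  classical
  have h1 : (e.live p)ᶜ.card ≤ f := by
    rw [← Set.ncard_coe_finset]
    refine le_trans (Set.ncard_le_ncard ?_ (Set.toFinite _)) e.crashes_le
    intro j hj
    have : j ∉ e.live p := by simpa using hj
    rw [mem_live, not_not] at this
    exact ⟨p, this⟩
  have h2 := Finset.card_compl_add_card (e.live p)
  simp only [Fintype.card_fin] at h2
  omega

/-- One delay for the request and one for the answer, so all live nodes, at least `n - f` of them,
have answered. The unchanged request number ensures that their answers still count. -/
theorem card_acks {θ : ℝ} {a p : ℕ} (h0 : 0 ≤ θ - D) (hD : 0 < D) (hp : e.LastUpTo θ p)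
    (ha : e.time a + 2 * D ≤ θ)
    {w : Fin n} (hw : w ∉ (e.cfg p).crashed) (hwait : ((e.cfg a).state w).pc.Waiting)
    (hreq : ((e.cfg p).state w).req = ((e.cfg a).state w).req) :
    n - f ≤ ((e.cfg p).state w).acks.card := by
  refine (e.card_live p).trans (Finset.card_le_card fun l hl => ?_)
  rw [mem_live] at hl
  have hap : a ≤ p := hp.le_of_time_le (by linarith)
  have hacks : ∀ b, a ≤ b → b ≤ p → l ∈ ((e.cfg b).state w).acks → l ∈ ((e.cfg p).state w).acks := by
    intro b h1 h2 h3
    have h4 := e.req_mono w h1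
    have h5 := e.req_mono w h2
    exact e.acks_mono h2 (by simp only at h4 h5; omega) h3
  have hack : ∀ b, a ≤ b → b ≤ p → e.time b + D ≤ θ → ∀ m τ, IsAck ((e.cfg a).state w).req m →
      (m, τ) ∈ (e.cfg b).chan l w → l ∈ ((e.cfg p).state w).acks := by
    intro b h1 h2 h3 m τ h4 h5
    have h6 : τ ≤ e.time b := e.sent_le_now b _ _ _ h5
    obtain ⟨d, h7, h8, h9⟩ := e.handles_of_mem hp hw (by linarith) h2 h5
    refine hacks (d + 1) (by omega) (by omega) ?_
    have h10 := e.req_mono w (h1.trans h7)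
    have h11 := e.req_mono w h8.le
    rw [h9.state]
    refine handle_ack ?_
    simp only at h10 h11
    rwa [show ((e.cfg d).state w).req = ((e.cfg a).state w).req by omega]
  rcases e.requestInv a w (e.not_crashed_of_le hap hw) hwait l with
    h1 | h1 | ⟨m, τ, h1, h2⟩ | ⟨m, τ, h1, h2⟩
  · exact absurd h1 (e.not_crashed_of_le hap hl)
  · exact hacks a le_rfl hap h1
  -- A request still on its way is handled by `θ - D`, which leaves `D` for the answer.
  · obtain ⟨p', hp'⟩ := e.exists_lastUpTo h0
    have hpp : p' ≤ p := hp'.mono hp (by linarith)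
    have h3 : τ ≤ e.time a := e.sent_le_now a _ _ _ h2
    obtain ⟨b, h4, h5, h6⟩ := e.handles_of_mem hp' (e.not_crashed_of_le hpp hl)
      (by linarith) (hp'.le_of_time_le (by linarith)) h2
    obtain ⟨m', h7, h8⟩ := handle_request (i := l) (j := w) (s := (e.cfg b).state l) h1
    have h9 := h6.sends (e.not_crashed_of_le (by omega) hl) _ _ h8
    refine hack (b + 1) (by omega) (by omega) ?_ m' _ h7 h9
    have := e.time_mono (show b + 1 ≤ p' by omega)
    linarith [hp'.time_le]
  · exact hack a le_rfl hap (by linarith) m τ h1 h2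

end Execution

/-! ### The tag returned by `readTag()` -/

/-- A `writeAck` with the current number would enlarge `acks` without contributing a tag, and
`ackTag` could stay too small; `h2` rules this out and is later supplied by `NumberInv`. -/
theorem Event.le_ackTag {i : Fin n} {s s' : NodeState Val n} {out : List (Send Val n)}
    {recv : Option (Fin n × Msg Val n)} (h : Event f i s s' out recv) {r : ℕ} {op : Op Val}
    (hs : s.pc = .readWait op → s.acks.Nonempty → r ≤ s.ackTag)
    (h1 : ∀ j t, recv = some (j, .readAck t s.req) → r ≤ t)
    (h2 : ∀ j t, s.pc = .readWait op → recv ≠ some (j, .writeAck t s.req))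
    (hpc : s'.pc = .readWait op) (ha : s'.acks.Nonempty) : r ≤ s'.ackTag := by
  cases h with
  | invoke => simp [NodeState.newRequest] at ha
  | client h => cases h <;> simp [NodeState.newRequest] at hpc
  | deliver j m =>
    rw [handle_pc] at hpc
    cases m <;> simp only [handle] at ha ⊢
    case readAck t q =>
      split_ifs at ha ⊢ with hq
      · subst hq
        exact (h1 j t rfl).trans (le_max_right _ _)
      · exact hs hpc ha
    case writeAck t q =>
      split_ifs at ha ⊢ with hq
      · subst hq
        exact absurd rfl (h2 j t hpc)
      · exact hs hpc ha
    all_goals exact hs hpc ha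

namespace Execution

variable (e : Execution Val n f D)

theorem state_succ_cases (p : ℕ) (j : Fin n) :
    (e.cfg (p + 1)).state j = (e.cfg p).state j ∨
      ∃ out recv, Acts f (e.cfg p) (e.cfg (p + 1)) j ((e.cfg (p + 1)).state j) out recv := by
  rcases (e.step p).acts_or_quiet with ⟨i, s', out, recv, h⟩ | h
  · by_cases hj : j = i
    · subst hj
      rw [h.state_self]
      exact .inr ⟨out, recv, h⟩
    · exact .inl (h.state_ne hj)
  · exact .inl (by rw [h.state])

theorem time_nonneg (p : ℕ) : 0 ≤ e.time p := by
  have := e.time_mono (Nat.zero_le p)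
  rwa [time, e.init] at this

theorem readWait_of_req_eq {a b : ℕ} (hab : a ≤ b) {w : Fin n} {op : Op Val}
    (hpc : ((e.cfg b).state w).pc = .readWait op)
    (hreq : ((e.cfg b).state w).req = ((e.cfg a).state w).req) :
    ((e.cfg a).state w).pc = .readWait op := by
  induction b, hab using Nat.le_induction with
  | base => exact hpc
  | succ b hb ih =>
    rcases e.state_succ_cases b w with h | ⟨out, recv, h⟩
    · rw [h] at hpc hreq
      exact ih hpc hreq
    · rcases h.event.readWait hpc with ⟨h1, h2⟩ | ⟨h1, _⟩
      · exact ih h1 (by omega)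
      · have := e.req_mono w hb
        simp only at this
        omega

/-- If at some time all live nodes know the tag `r`, then every later `readTag()` returns at
least `r`. -/
theorem le_ackTag {a p r : ℕ} (hap : a ≤ p)
    (hr : ∀ l, l ∉ (e.cfg a).crashed → r ≤ ((e.cfg a).state l).maxTag) {w : Fin n}
    (hreq : ((e.cfg a).state w).req < ((e.cfg p).state w).req) {op : Op Val}
    (hpc : ((e.cfg p).state w).pc = .readWait op) (hacks : ((e.cfg p).state w).acks.Nonempty) :
    r ≤ ((e.cfg p).state w).ackTag := by
  suffices h : (∀ l, l ∉ (e.cfg p).crashed → r ≤ ((e.cfg p).state l).maxTag) ∧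
      (∀ l w t q τ, (.readAck t q, τ) ∈ (e.cfg p).chan l w → ((e.cfg a).state w).req < q → r ≤ t) ∧
      ∀ w, ((e.cfg a).state w).req < ((e.cfg p).state w).req → ∀ op,
        ((e.cfg p).state w).pc = .readWait op → ((e.cfg p).state w).acks.Nonempty →
        r ≤ ((e.cfg p).state w).ackTag from h.2.2 w hreq op hpc hacks
  clear hreq hpc hacks w op
  refine e.induction_from (P := fun c => (∀ l, l ∉ c.crashed → r ≤ (c.state l).maxTag) ∧
    (∀ l w t q τ, (.readAck t q, τ) ∈ c.chan l w → ((e.cfg a).state w).req < q → r ≤ t) ∧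
    ∀ w, ((e.cfg a).state w).req < (c.state w).req → ∀ op,
      (c.state w).pc = .readWait op → (c.state w).acks.Nonempty → r ≤ (c.state w).ackTag)
    ⟨hr, ?_, ?_⟩ ?_ ?_ hap
  -- Initially no acknowledgement in transit has a number beyond the current one, so only answers
  -- given after the `a`-th configuration matter.
  · intro l w t q τ h1 h2
    exact absurd ((e.numberInv a).ack w l _ τ q ⟨t, .inl rfl⟩ h1) (by omega)
  · intro w h
    exact absurd h (lt_irrefl _)
  · rintro p - h ⟨h1, h2, h3⟩
    rw [h.state, h.chan]
    exact ⟨fun l hl => h1 l fun h' => hl (h.crashed_mono h'), h2, h3⟩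
  · rintro p - i s' out recv h ⟨h1, h2, h3⟩
    refine ⟨?_, ?_, ?_⟩
    · intro l hl
      exact (h1 l fun h' => hl (h.crashed_mono h')).trans (e.maxTag_mono l p.le_succ)
    · intro l w t q τ hμ hq
      rcases h.chan_new _ _ _ hμ with h4 | ⟨rfl, _, h4⟩
      · exact h2 _ _ _ _ _ h4 hq
      · rw [(h.event.emits_readAck h4).1]
        exact h1 _ h.live
    · intro w hq op hpc hacks
      by_cases hw : w = i
      · subst hw
        rw [h.state_self] at hq hpc hacks ⊢
        by_cases hlt : ((e.cfg a).state w).req < ((e.cfg p).state w).req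
        · refine h.event.le_ackTag (h3 w hlt op) ?_ ?_ hpc hacks
          · intro j t hrecv
            obtain ⟨τ, hτ⟩ := h.recv_mem _ _ hrecv
            exact h2 _ _ _ _ _ hτ hlt
          · intro j t hp hrecv
            obtain ⟨τ, hτ⟩ := h.recv_mem _ _ hrecv
            exact absurd ((e.numberInv p).writeAck _ _ _ _ _ hτ op hp) (lt_irrefl _)
        · rcases h.event.readWait hpc with ⟨_, h4⟩ | ⟨_, h4⟩
          · omega
          · simp [h4] at hacks
      · rw [h.state_ne hw] at hq hpc hacks ⊢
        exact h3 w hq op hpc hacks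

/-- If all live nodes know the tag `r` at time `θ`, then every `readTag()` that ends after time
`θ + 2 * D` returns at least `r`. -/
theorem le_ackTag_of_time_lt (hf : f < n) (hD : 0 < D) {θ : ℝ} (hθ : 0 ≤ θ) {a p r : ℕ}
    (ha : e.LastUpTo θ a) (hr : ∀ l, l ∉ (e.cfg a).crashed → r ≤ ((e.cfg a).state l).maxTag)
    (hp : θ + 2 * D < e.time p) {w : Fin n} (hw : w ∉ (e.cfg p).crashed) {op : Op Val}
    (hpc : ((e.cfg p).state w).pc = .readWait op)
    (hacks : n - f ≤ ((e.cfg p).state w).acks.card) : r ≤ ((e.cfg p).state w).ackTag := by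
  obtain ⟨b, hb⟩ := e.exists_lastUpTo (θ := θ + 2 * D) (by linarith)
  have hab : a ≤ b := ha.mono hb (by linarith)
  have hbp : b ≤ p := by
    by_contra! hc
    have := e.time_mono hc.le
    linarith [hb.time_le]
  -- A request already pending at `θ` would have its quorum of answers by `θ + 2D` and could not
  -- still be waiting afterwards; so the request is newer than `θ`.
  have hreq : ((e.cfg a).state w).req < ((e.cfg p).state w).req := by
    by_contra! hc
    have h1 := e.req_mono w hab
    have h2 := e.req_mono w hbp
    simp only at h1 h2
    have hpca := e.readWait_of_req_eq (hab.trans hbp) hpc (by omega)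
    have hpcb := e.readWait_of_req_eq hbp hpc (by omega)
    have hwb := e.not_crashed_of_le hbp hw
    have hcard := e.card_acks (by linarith) hD hb (by linarith [ha.time_le]) hwb
      (.inl ⟨op, hpca⟩) (by omega)
    cases op with
    | update v => exact hb.blocked w hwb _ _ (.readDoneUpdate _ v hpcb hcard)
    | scan => exact hb.blocked w hwb _ _ (.readDoneScan _ hpcb hcard)
  exact e.le_ackTag (hab.trans hbp) hr hreq hpc (Finset.card_pos.1 (by omega))

/-! ## The spreading of a value -/

open Classical in
/-- The nodes that crash in the step in which they send `x` to all. -/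
noncomputable def interrupted (x : Value Val n) : Finset (Fin n) :=
  {j | ∃ p, j ∉ (e.cfg p).crashed ∧ j ∈ (e.cfg (p + 1)).crashed ∧
    x ∉ ((e.cfg p).state j).sent ∧ x ∈ ((e.cfg (p + 1)).state j).sent}

theorem mem_interrupted {x : Value Val n} {j : Fin n} : j ∈ e.interrupted x ↔
    ∃ p, j ∉ (e.cfg p).crashed ∧ j ∈ (e.cfg (p + 1)).crashed ∧
      x ∉ ((e.cfg p).state j).sent ∧ x ∈ ((e.cfg (p + 1)).state j).sent := by
  simp [interrupted]

/-- A node crashes only once, and in that step it starts sending at most one new value. -/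
theorem disjoint_interrupted {x y : Value Val n} (hxy : x ≠ y) :
    Disjoint (e.interrupted x) (e.interrupted y) := by
  rw [Finset.disjoint_left]
  intro j hx hy
  rw [mem_interrupted] at hx hy
  obtain ⟨p, h1, h2, h3, h4⟩ := hx
  obtain ⟨q, h5, h6, h7, h8⟩ := hy
  have hpq : p = q := by
    rcases lt_trichotomy p q with h | h | h
    · exact absurd (e.crashed_mono (show p + 1 ≤ q from h) h2) h5
    · exact h
    · exact absurd (e.crashed_mono (show q + 1 ≤ p from h) h6) h1
  subst hpq
  rcases e.state_succ_cases p j with h | ⟨out, recv, h⟩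
  · rw [h] at h4
    exact h3 h4
  · exact hxy (h.event.sent_unique h4 h3 h8 h7)

theorem sum_card_interrupted_le {ι : Type*} (s : Finset ι) {x : ι → Value Val n}
    (hx : Set.InjOn x s) : ∑ c ∈ s, (e.interrupted (x c)).card ≤ e.crashes := by
  classical
  rw [← Finset.card_biUnion fun c hc d hd hcd => e.disjoint_interrupted (hx.ne hc hd hcd),
    ← Set.ncard_coe_finset]
  refine Set.ncard_le_ncard ?_ (Set.toFinite _)
  intro j hj
  simp only [Finset.coe_biUnion, Set.mem_iUnion, Finset.mem_coe, mem_interrupted] at hj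
  obtain ⟨c, _, p, _, h, _⟩ := hj
  exact ⟨p + 1, h⟩

theorem notMem_interrupted {x : Value Val n} {j : Fin n} {p : ℕ} (hj : j ∉ (e.cfg p).crashed)
    (hx : x ∈ ((e.cfg p).state j).sent) : j ∉ e.interrupted x := by
  rw [mem_interrupted]
  rintro ⟨q, _, h2, h3, _⟩
  rcases le_or_gt p q with h | h
  · exact h3 (e.sent_mono j h hx)
  · exact hj (e.crashed_mono (show q + 1 ≤ p from h) h2)

open Classical in
/-- The nodes that have sent `x` to all, completely or not. -/
noncomputable def senders (p : ℕ) (x : Value Val n) : Finset (Fin n) :=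
  {j | x ∈ ((e.cfg p).state j).sent}

theorem mem_senders {p : ℕ} {x : Value Val n} {j : Fin n} :
    j ∈ e.senders p x ↔ x ∈ ((e.cfg p).state j).sent := by
  simp [senders]

theorem senders_mono (x : Value Val n) {p q : ℕ} (h : p ≤ q) : e.senders p x ⊆ e.senders q x := by
  intro j hj
  rw [mem_senders] at *
  exact e.sent_mono j h hj

/-- If the value `x` is written up to time `T`, then each hop delays it by at most `D`. -/
theorem value_sent_le (hD : 0 < D) {x : Value Val n} {T : ℝ}
    (hT : ∀ p w, w ∉ (e.cfg p).crashed → Writes f w ((e.cfg p).state w) x → e.time p ≤ T)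
    (p : ℕ) : ∀ j l τ, (.value x, τ) ∈ (e.cfg p).chan j l →
      τ ≤ T + ((e.senders p x).card - 1) * D := by
  induction p with
  | zero => simp [e.init, Config.init]
  | succ p ih =>
    have hcard : ((e.senders p x).card : ℝ) ≤ (e.senders (p + 1) x).card := by
      exact_mod_cast Finset.card_le_card (e.senders_mono x p.le_succ)
    have hold : ∀ j l τ, (.value x, τ) ∈ (e.cfg p).chan j l →
        τ ≤ T + ((e.senders (p + 1) x).card - 1) * D := fun j l τ h =>
      (ih j l τ h).trans (by gcongr)
    intro j l τ h
    rcases (e.step p).acts_or_quiet with ⟨i, s', out, recv, hA⟩ | hQ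
    · rcases hA.chan_new _ _ _ h with h1 | ⟨rfl, h2, h1⟩
      · exact hold j l τ h1
      · simp only at h2
        subst h2
        obtain ⟨hs, hw | ⟨⟨j', hr⟩, hns⟩⟩ := hA.event.emits_value h1
        · have h3 : (1 : ℝ) ≤ (e.senders (p + 1) x).card := by
            exact_mod_cast Finset.card_pos.2
              ⟨j, (e.mem_senders).2 (by rw [hA.state_self]; exact hs)⟩
          have h4 : (e.cfg p).now ≤ T := hT p _ hA.live hw
          nlinarith
        · obtain ⟨σ, hσ⟩ := hA.recv_mem _ _ hr
          have h3 := ih _ _ _ hσ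
          have h4 := e.now_le_deadline hD p _ _ hA.live _ hσ
          -- The forwarder is a new sender, and the increase of the count pays for the delay `D` of
          -- this hop. Counting all senders makes it unnecessary to follow chains of messages.
          have h5 : ((e.senders p x).card : ℝ) + 1 ≤ (e.senders (p + 1) x).card := by
            exact_mod_cast Finset.card_lt_card (Finset.ssubset_iff_subset_ne.2
              ⟨e.senders_mono x p.le_succ, fun heq => hns <| e.mem_senders.1 <|
                heq ▸ e.mem_senders.2 (by rw [hA.state_self]; exact hs)⟩)
          simp only at h4
          nlinarith
    · rw [hQ.chan] at h
      exact hold j l τ h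

/-- The `q`-th configuration is the first one in which a live node has sent `x` to all. -/
structure FirstSent (q : ℕ) (x : Value Val n) : Prop where
  sent : ∃ j, j ∉ (e.cfg q).crashed ∧ x ∈ ((e.cfg q).state j).sent
  before : ∀ p, p < q → ∀ j, j ∉ (e.cfg p).crashed → x ∉ ((e.cfg p).state j).sent

variable {e} in
theorem FirstSent.unique {q q' : ℕ} {x : Value Val n} (h : e.FirstSent q x)
    (h' : e.FirstSent q' x) : q = q' := by
  obtain ⟨j, h1, h2⟩ := h.sent
  obtain ⟨j', h3, h4⟩ := h'.sent
  rcases lt_trichotomy q q' with hq | hq | hq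
  · exact absurd h2 (h'.before _ hq j h1)
  · exact hq
  · exact absurd h4 (h.before _ hq j' h3)

/-- Take the first sender outside `interrupted x`. It survives the sending step, while all senders
before it are interrupted ones, so `value_sent_le` bounds its time by the number of interruptions.
-/
theorem exists_firstSent (hD : 0 < D) {x : Value Val n} {T : ℝ}
    (hT : ∀ p w, w ∉ (e.cfg p).crashed → Writes f w ((e.cfg p).state w) x → e.time p ≤ T)
    {p : ℕ} {j : Fin n} (hj : j ∉ (e.cfg p).crashed) (hx : x ∈ ((e.cfg p).state j).sent) :
    ∃ q, q ≤ p ∧ e.FirstSent q x ∧ e.time q ≤ T + (e.interrupted x).card * D := by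
  classical
  have hex : ∃ q j, j ∉ e.interrupted x ∧ x ∈ ((e.cfg q).state j).sent :=
    ⟨p, j, e.notMem_interrupted hj hx, hx⟩
  have hmin : ∀ q, q < Nat.find hex → ∀ j, x ∈ ((e.cfg q).state j).sent → j ∈ e.interrupted x :=
    fun q hq j hx => by_contra fun h => Nat.find_min hex hq ⟨j, h, hx⟩
  obtain ⟨j', h1, h2⟩ := Nat.find_spec hex
  refine ⟨Nat.find hex, Nat.find_min' hex ⟨j, e.notMem_interrupted hj hx, hx⟩, ?_⟩
  obtain ⟨q, hq⟩ : ∃ q, Nat.find hex = q + 1 := by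
    refine Nat.exists_eq_succ_of_ne_zero fun h0 => ?_
    rw [h0, e.init] at h2
    simp [Config.init, NodeState.init] at h2
  rw [hq] at h2 hmin ⊢
  have h3 : x ∉ ((e.cfg q).state j').sent := fun h => h1 (hmin q q.lt_succ_self _ h)
  rcases e.state_succ_cases q j' with h | ⟨out, recv, h⟩
  · rw [h] at h2
    exact absurd h2 h3
  have h4 : j' ∉ (e.cfg (q + 1)).crashed := fun hc =>
    h1 (e.mem_interrupted.2 ⟨q, h.live, hc, h3, h2⟩)
  refine ⟨⟨⟨j', h4, h2⟩, fun r hr l hl hxl =>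
    e.notMem_interrupted hl hxl (hmin r hr l hxl)⟩, ?_⟩
  have h5 : e.time (q + 1) = e.time q := h.now
  rw [h5]
  rcases (h.event.mem_sent h2 h3).2 with hw | ⟨l, hr⟩
  · exact (hT q j' h.live hw).trans (le_add_of_nonneg_right (by positivity))
  · obtain ⟨τ, hτ⟩ := h.recv_mem _ _ hr
    have h6 := e.value_sent_le hD hT q _ _ _ hτ
    have h7 := e.now_le_deadline hD q _ _ h.live _ hτ
    have h8 : ((e.senders q x).card : ℝ) ≤ (e.interrupted x).card := by
      exact_mod_cast Finset.card_le_card fun l hl => hmin q q.lt_succ_self l (e.mem_senders.1 hl)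
    simp only at h7
    unfold time
    nlinarith

theorem mem_V_of_sent {θ : ℝ} {p q : ℕ} (hp : e.LastUpTo θ p) (hq : e.time q + D ≤ θ)
    (hqp : q ≤ p) {x : Value Val n} {j l : Fin n} (hj : j ∉ (e.cfg q).crashed)
    (hx : x ∈ ((e.cfg q).state j).sent) (hl : l ∉ (e.cfg p).crashed) :
    x ∈ ((e.cfg p).state l).V j := by
  rcases (e.valueInv q).delivered j hj x hx l with ⟨τ, hτ⟩ | h
  · have h1 : τ ≤ e.time q := e.sent_le_now q _ _ _ hτ
    obtain ⟨b, _, h2, h3⟩ := e.handles_of_mem hp hl (by linarith) hqp hτ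
    refine e.V_mono l j (show b + 1 ≤ p from h2) ?_
    simp only [h3.state]
    exact (handle_value_mem _ _ _ _).1
  · exact e.V_mono l j hqp h

/-- Two hops: by `θ - D` node `l` has received `x` and forwarded it, and by `θ` this copy has
reached `i`. The node that first sent `x` may have crashed meanwhile, since its sending was
complete. -/
theorem mem_V_of_firstSent (hD : 0 < D) {θ : ℝ} {p q : ℕ} (hp : e.LastUpTo θ p)
    {x : Value Val n} (hx : e.FirstSent q x) (hq : e.time q + 2 * D ≤ θ) {i l : Fin n}
    (hi : i ∉ (e.cfg p).crashed) (hl : l ∉ (e.cfg p).crashed) :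
    x ∈ ((e.cfg p).state i).V l := by
  obtain ⟨j, h1, h2⟩ := hx.sent
  obtain ⟨a, ha⟩ := e.exists_lastUpTo (θ := θ - D) (by linarith [e.time_nonneg q])
  have hap : a ≤ p := ha.mono hp (by linarith)
  have hla := e.not_crashed_of_le hap hl
  have h3 := e.mem_V_of_sent ha (by linarith) (ha.le_of_time_le (by linarith)) h1 h2 hla
  exact e.mem_V_of_sent hp (by linarith [ha.time_le]) hap hla
    ((e.valueInv a).V_forwarded l j h3) hi

/-! ## Lattice operations -/

/-- If the equivalence quorum is missing at time `θ`, then some value is spreading. -/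
theorem exists_spreading (hD : 0 < D) {θ T : ℝ} {p r : ℕ} (hp : e.LastUpTo θ p)
    (hT : ∀ x : Value Val n, x.tag ≤ r → ∀ p w, w ∉ (e.cfg p).crashed →
      Writes f w ((e.cfg p).state w) x → e.time p ≤ T)
    {i : Fin n} (hi : i ∉ (e.cfg p).crashed)
    (hEQ : ¬ EQ f (fun j => (((e.cfg p).state i).V j).upTo r) i) :
    ∃ x q, e.FirstSent q x ∧ e.time q ≤ T + (e.interrupted x).card * D ∧ e.time q ≤ θ ∧
      θ < e.time q + 2 * D := by
  by_contra! hc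
  -- If no value is spreading, the live nodes themselves form the quorum: a value that `i` has from
  -- one of them, it has from all of them.
  refine hEQ ⟨e.live p, e.card_live p, fun l hl => ?_⟩
  rw [mem_live] at hl
  have key : ∀ x : Value Val n, x.tag ≤ r → ∀ j, j ∉ (e.cfg p).crashed →
      x ∈ ((e.cfg p).state i).V j → ∀ l, l ∉ (e.cfg p).crashed → x ∈ ((e.cfg p).state i).V l := by
    intro x hx j hj hxj l hl
    obtain ⟨q, h1, h2, h3⟩ := e.exists_firstSent hD (hT x hx) hj ((e.valueInv p).V_sent i j hxj)
    have h4 := hc x q h2 h3 ((e.time_mono h1).trans hp.time_le)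
    exact e.mem_V_of_firstSent hD hp h2 h4 hi hl
  ext x
  exact ⟨fun h => ⟨key x h.2 l hl h.1 i hi, h.2⟩, fun h => ⟨key x h.2 i hi h.1 l hl, h.2⟩⟩

/-- The source of the square root: a failed test costs more than `⌈√k⌉` crashes, and different tests
are charged to different crashes, so `⌈√k⌉ + 1` tests cannot all fail. -/
theorem exists_EQ (hD : 0 < D) {T : ℝ} {r : ℕ}
    (hT : ∀ x : Value Val n, x.tag ≤ r → ∀ p w, w ∉ (e.cfg p).crashed →
      Writes f w ((e.cfg p).state w) x → e.time p ≤ T) (i : Fin n) :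
    ∃ c ≤ ⌈√(e.crashes : ℝ)⌉₊, ∀ p, e.LastUpTo (T + (⌈√(e.crashes : ℝ)⌉₊ + 2 + 2 * c) * D) p →
      i ∉ (e.cfg p).crashed → EQ f (fun j => (((e.cfg p).state i).V j).upTo r) i := by
  by_contra! hc
  set a := ⌈√(e.crashes : ℝ)⌉₊ with ha
  have hx : ∀ c : ℕ, ∃ x q, c ≤ a → e.FirstSent q x ∧ a + 1 ≤ (e.interrupted x).card ∧
      e.time q ≤ T + (a + 2 + 2 * c) * D ∧ T + (a + 2 + 2 * c) * D < e.time q + 2 * D := by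
    intro c
    by_cases hca : c ≤ a
    swap
    -- Beyond `a` nothing is claimed, but `choose` needs some value; the test `c = 0` provides one.
    · by_contra! hn
      obtain ⟨p, hp, hi, hEQ⟩ := hc 0 (Nat.zero_le _)
      obtain ⟨x, q, _⟩ := e.exists_spreading hD hp hT hi hEQ
      exact hca (hn x q).1
    obtain ⟨p, hp, hi, hEQ⟩ := hc c hca
    obtain ⟨x, q, h1, h2, h3, h4⟩ := e.exists_spreading hD hp hT hi hEQ
    refine ⟨x, q, fun _ => ⟨h1, ?_, h3, h4⟩⟩
    -- The first complete sending is later than `T + (a + 2c) D`, yet at most `|I(x)| D` after `T`.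
    have h5 : ((a : ℝ) + 2 * c) * D < (e.interrupted x).card * D := by linarith
    have h6 := lt_of_mul_lt_mul_right h5 hD.le
    have h7 : a + 2 * c < (e.interrupted x).card := by exact_mod_cast h6
    omega
  choose x q hxq using hx
  -- The first complete sendings lie in the disjoint half-open windows of length `2D` that end at
  -- the tested instants.
  have hinj : Set.InjOn x (Finset.range (a + 1)) := by
    intro c hc d hd hcd
    simp only [Finset.coe_range, Set.mem_Iio] at hc hd
    obtain ⟨h1, _, h3, h4⟩ := hxq c (by omega)
    obtain ⟨h5, _, h7, h8⟩ := hxq d (by omega)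
    rw [hcd] at h1
    rw [h1.unique h5] at h3 h4
    have h9 : (c : ℝ) * D < (d + 1) * D := by nlinarith
    have h10 : (d : ℝ) * D < (c + 1) * D := by nlinarith
    have h11 : c < d + 1 := by exact_mod_cast lt_of_mul_lt_mul_right h9 hD.le
    have h12 : d < c + 1 := by exact_mod_cast lt_of_mul_lt_mul_right h10 hD.le
    omega
  have h1 := e.sum_card_interrupted_le _ hinj
  have h2 : (a + 1) * (a + 1) ≤ ∑ c ∈ Finset.range (a + 1), (e.interrupted (x c)).card := by
    have := Finset.card_nsmul_le_sum (Finset.range (a + 1)) (fun c => (e.interrupted (x c)).card)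
      (a + 1) fun c hc => (hxq c (by simp at hc; omega)).2.1
    simpa using this
  have h3 : √(e.crashes : ℝ) ≤ a := Nat.le_ceil _
  have h4 : (e.crashes : ℝ) ≤ a ^ 2 := (Real.sqrt_le_left (Nat.cast_nonneg _)).1 h3
  have h5 : e.crashes ≤ a ^ 2 := by exact_mod_cast h4
  nlinarith

theorem LatticeStarts.time_succ {e : Execution Val n f D} {i : Fin n} {op : Op Val} {ph r m : ℕ}
    (h : e.LatticeStarts i op ph r m) : e.time (m + 1) = e.time m := by
  rcases e.state_succ_cases m i with h1 | ⟨out, recv, h1⟩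
  · have h2 := h.1
    have h3 := h.2
    rw [pc] at h2 h3
    rw [h1, h2] at h3
    simp at h3
  · exact h1.now

theorem le_maxTag_of_latticeStarts (hD : 0 < D) {i : Fin n} {op : Op Val} {ph r m p : ℕ}
    (hs : e.LatticeStarts i op ph r m) (hp : e.LastUpTo (e.time m + D) p)
    (hi : i ∉ (e.cfg p).crashed) (l : Fin n) (hl : l ∉ (e.cfg p).crashed) :
    r ≤ ((e.cfg p).state l).maxTag := by
  have ht := hs.time_succ
  have hmp : m + 1 ≤ p := hp.le_of_time_le (by linarith)
  rcases e.writeTagInv (m + 1) i (e.not_crashed_of_le hmp hi) op ph r (.inl hs.2) l with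
    h | h | ⟨q, τ, h⟩
  · exact absurd h (e.not_crashed_of_le hmp hl)
  · exact h.trans (e.maxTag_mono l hmp)
  · have h1 : τ ≤ e.time (m + 1) := e.sent_le_now _ _ _ _ h
    obtain ⟨b, _, h2, h3⟩ := e.handles_of_mem hp hl (by linarith) hmp h
    refine le_trans ?_ (e.maxTag_mono l (show b + 1 ≤ p from h2))
    simp only [h3.state]
    exact handle_writeTag_maxTag _ _ _ _ _

/-- A lattice operation can be left only through `latticeRet`, which would be a return in time. -/
theorem inLattice_of_not_returns {i : Fin n} {op : Op Val} {ph r m P : ℕ} {t : ℝ}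
    (hs : e.LatticeStarts i op ph r m) (hP : e.time P ≤ t) (hi : i ∉ (e.cfg P).crashed)
    (hret : ¬ e.LatticeReturnsBy i op ph r m t) {p : ℕ} (hmp : m + 1 ≤ p) (hpP : p ≤ P) :
    (e.pc i p).InLattice op ph r := by
  suffices h : ∀ q, m < q → q ≤ p → (e.pc i q).InLattice op ph r from h p hmp le_rfl
  induction p, hmp using Nat.le_induction with
  | base =>
    intro q h1 h2
    obtain rfl : q = m + 1 := by omega
    exact .inl hs.2
  | succ p hp ih =>
    intro q h1 h2
    have ih := ih (by omega)
    rcases Nat.lt_or_ge q (p + 1) with h3 | h3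
    · exact ih q h1 (by omega)
    obtain rfl : q = p + 1 := by omega
    have hin := ih p (by omega) le_rfl
    unfold pc at hin ⊢
    rcases e.state_succ_cases p i with h | ⟨out, recv, h⟩
    · rwa [h]
    · rcases h.event.of_inLattice hin with h4 | ⟨res, h4⟩
      · exact h4.1
      · exact absurd ⟨p, by omega, (e.time_mono (by omega : p ≤ P)).trans hP, ih, ⟨res, h4⟩,
          e.not_crashed_of_le hpP hi⟩ hret

theorem inLattice_mono {i : Fin n} {op : Op Val} {ph r a b : ℕ} (hab : a ≤ b)
    (hin : ∀ p, a ≤ p → p ≤ b → (e.pc i p).InLattice op ph r) :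
    (e.pc i a = .eqWait op ph r → e.pc i b = .eqWait op ph r) ∧
      ((e.cfg b).state i).req = ((e.cfg a).state i).req := by
  induction b, hab using Nat.le_induction with
  | base => exact ⟨id, rfl⟩
  | succ b hb ih =>
    obtain ⟨h1, h2⟩ := ih fun p h3 h4 => hin p h3 (by omega)
    have h3 := hin b hb (by omega)
    have h4 := hin (b + 1) (by omega) le_rfl
    unfold pc at h1 h3 h4 ⊢
    rcases e.state_succ_cases b i with h | ⟨out, recv, h⟩
    · rw [h]
      exact ⟨h1, h2⟩
    · rcases h.event.of_inLattice h3 with ⟨_, h5, h6⟩ | ⟨res, h5⟩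
      · exact ⟨fun h => h5 (h1 h), h6.trans h2⟩
      · simp [PC.InLattice, h5] at h4

/-- The bound adds `3D` until no value with tag at most `r` is written any more and `(a + 2 + 2a) D`
until the last test of `exists_EQ`. -/
theorem lattice_returns (hf : f < n) (hD : 0 < D) {i : Fin n} {op : Op Val} {ph r m : ℕ} {B : ℝ}
    (hB : (5 + 3 * (⌈√(e.crashes : ℝ)⌉₊ : ℝ)) * D ≤ B) (hs : e.LatticeStarts i op ph r m) :
    e.LatticeReturnsBy i op ph r m (e.time m + B) ∨ e.CrashedBy i (e.time m + B) := by
  by_contra! hc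
  obtain ⟨hret, hcr⟩ := hc
  set a := ⌈√(e.crashes : ℝ)⌉₊
  have ht0 := e.time_nonneg m
  have haD : 0 ≤ a * D := by positivity
  obtain ⟨P, hP⟩ := e.exists_lastUpTo (θ := e.time m + B) (by linarith)
  have hiP : i ∉ (e.cfg P).crashed := fun h => hcr ⟨P, h, hP.time_le⟩
  have hin : ∀ p, m + 1 ≤ p → p ≤ P → (e.pc i p).InLattice op ph r := fun p h1 h2 =>
    e.inLattice_of_not_returns hs hP.time_le hiP hret h1 h2
  have hts := hs.time_succ
  obtain ⟨p₁, hp₁⟩ := e.exists_lastUpTo (θ := e.time m + D) (by linarith)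
  obtain ⟨p₂, hp₂⟩ := e.exists_lastUpTo (θ := e.time m + 2 * D) (by linarith)
  have h1P : p₁ ≤ P := hp₁.mono hP (by linarith)
  have h2P : p₂ ≤ P := hp₂.mono hP (by linarith)
  have hm2 : m + 1 ≤ p₂ := hp₂.le_of_time_le (by linarith)
  have heq : e.pc i p₂ = .eqWait op ph r := by
    refine (hin p₂ hm2 h2P).resolve_left fun hw => ?_
    have hi2 := e.not_crashed_of_le h2P hiP
    refine hp₂.blocked i hi2 _ _ (.writeDone _ op ph r hw ?_)
    exact e.card_acks (by linarith) hD hp₂ (by linarith) hi2 (.inr ⟨op, ph, r, hs.2⟩)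
      (e.inLattice_mono hm2 fun p h1 h2 => hin p h1 (by omega)).2
  have hmax := e.le_maxTag_of_latticeStarts hD hs hp₁ (e.not_crashed_of_le h1P hiP)
  -- All live nodes know `r` after `D`; a `readTag()` ending more than `2D` later returns at least
  -- `r`, so the value written then has tag at least `r + 1`.
  obtain ⟨c, hca, hEQ⟩ := e.exists_EQ hD (T := e.time m + D + 2 * D) (r := r) (by
    intro x hx p w hw hwr
    by_contra! hlt
    obtain ⟨v, h1, h2, h3⟩ := hwr
    have := e.le_ackTag_of_time_lt hf hD (by linarith) hp₁ hmax hlt hw h1 h2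
    rw [h3] at hx
    simp only at hx
    omega) i
  have hcD : (c : ℝ) * D ≤ a * D := by gcongr
  have hcD0 : 0 ≤ (c : ℝ) * D := by positivity
  obtain ⟨p, hp⟩ := e.exists_lastUpTo (θ := e.time m + D + 2 * D + (a + 2 + 2 * c) * D)
    (by nlinarith)
  have hpP : p ≤ P := hp.mono hP (by nlinarith)
  have h2p : p₂ ≤ p := hp₂.mono hp (by nlinarith)
  have hip := e.not_crashed_of_le hpP hiP
  have hpc := (e.inLattice_mono h2p fun p h1 h2 => hin p (by omega) (by omega)).1 heq
  have hEQp := hEQ p hp hip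
  rcases le_or_gt ((e.cfg p).state i).maxTag r with h | h
  · exact hp.blocked i hip _ _ (.latticeGood _ op ph r hpc hEQp h)
  · exact hp.blocked i hip _ _ (.latticeBad _ op ph r hpc hEQp h)

end Execution

/-! ## Good lattice operations -/

/-- The tag that other nodes may learn from a message. -/
def Msg.tagOf : Msg Val n → ℕ
  | .writeTag t _ => t
  | .readAck t _ => t
  | .echoTag t => t
  | _ => 0

/-- The tag of the current lattice operation. -/
def PC.tagOf : PC Val n → ℕ
  | .latticeCall _ _ r => r
  | .writeWait _ _ r => r
  | .eqWait _ _ r => r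
  | .latticeRet _ _ r _ => r
  | _ => 0

/-- The phase is at most `3`, and a larger tag is known when a lattice operation has failed. -/
def PC.WellFormed (maxTag : ℕ) : PC Val n → Prop
  | .latticeCall _ ph _ => ph ≤ 3
  | .writeWait _ ph _ => ph ≤ 3
  | .eqWait _ ph _ => ph ≤ 3
  | .latticeRet _ ph r res => ph ≤ 3 ∧ (res = none → r < maxTag)
  | .borrowWait _ r => r < maxTag
  | _ => True

/-- The progress of the pending operation. -/
def PC.rank : PC Val n → ℕ
  | .latticeCall _ ph _ => ph + 1
  | .writeWait _ ph _ => ph + 1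
  | .eqWait _ ph _ => ph + 1
  | .latticeRet _ ph _ _ => ph + 2
  | .borrowWait _ _ => 5
  | _ => 0

section Event

variable {i : Fin n} {s s' : NodeState Val n} {out : List (Send Val n)}
  {recv : Option (Fin n × Msg Val n)}

theorem PC.WellFormed.mono {t t' : ℕ} (h : t ≤ t') {pc : PC Val n} (hpc : pc.WellFormed t) :
    pc.WellFormed t' := by
  cases pc <;> simp only [PC.WellFormed] at hpc ⊢
  case latticeRet => exact ⟨hpc.1, fun h' => (hpc.2 h').trans_le h⟩
  all_goals omega

theorem Event.wellFormed (h : Event f i s s' out recv) (hs : s.pc.WellFormed s.maxTag) :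
    s'.pc.WellFormed s'.maxTag := by
  have hm := h.mono.2.1
  cases h with
  | invoke => trivial
  | client h =>
    cases h <;> simp_all [PC.WellFormed, NodeState.newRequest]
    omega
  | deliver j m =>
    rw [handle_pc]
    exact hs.mono hm

theorem Event.rank_le (h : Event f i s s' out recv) (hs : s.pc ≠ .idle) (hs' : s'.pc ≠ .idle) :
    s.pc.rank ≤ s'.pc.rank := by
  cases h with
  | invoke op h => exact absurd h hs
  | client h => cases h <;> simp_all [PC.rank, NodeState.newRequest]
  | deliver => rw [handle_pc]

theorem Event.borrowWait (h : Event f i s s' out recv) {op : Op Val} {r : ℕ}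
    (hs : s.pc = .borrowWait op r) (hs' : s'.pc ≠ .idle) : s'.pc = .borrowWait op r := by
  cases h with
  | invoke op h => simp [h] at hs
  | client h => cases h <;> simp_all
  | deliver => rwa [handle_pc]

theorem Event.latticeRet_some (h : Event f i s s' out recv) {op : Op Val} {ph r : ℕ}
    {v : View Val n} (hs' : s'.pc = .latticeRet op ph r (some v)) :
    s.pc = .latticeRet op ph r (some v) ∨ ∀ b, Emits out b (.goodLA r) := by
  cases h with
  | invoke => simp [NodeState.newRequest] at hs'
  | client h => cases h <;> simp_all [NodeState.newRequest]
  | deliver => exact .inl (by simpa using hs')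

theorem Event.idle_of_readWait (h : Event f i s s' out recv) {op : Op Val}
    (hs' : s'.pc = .readWait op) (hreq : s'.req ≠ s.req) : s.pc = .idle := by
  cases h with
  | invoke op h => exact h
  | client h => cases h <;> simp [NodeState.newRequest] at hs'
  | deliver => exact absurd (handle_req _ _ _ _) hreq

/-- All steps but one merely copy or compare existing tags. The exception is `afterPhaseZero`, which
creates `t + 1` from `t`; it exceeds `r` only when `t = r`, the case excluded by `h0`. The tags of
written values do not count, as they never enter `maxTag`. -/
theorem Event.tagOf_le (h : Event f i s s' out recv) {r : ℕ} (hm : s.maxTag ≤ r)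
    (ha : s.ackTag ≤ r) (hp : s.pc.tagOf ≤ r) (hr : ∀ j m, recv = some (j, m) → m.tagOf ≤ r)
    (h0 : ∀ op res, s.pc ≠ .latticeRet op 0 r res) :
    s'.maxTag ≤ r ∧ s'.ackTag ≤ r ∧ s'.pc.tagOf ≤ r ∧ ∀ b m, Emits out b m → m.tagOf ≤ r := by
  cases h with
  | invoke => simp [PC.tagOf, Msg.tagOf, NodeState.newRequest, hm]
  | client h =>
    cases h
    case afterPhaseZero op t res h =>
      have h1 : t ≠ r := fun h2 => h0 op res (h2 ▸ h)
      simp_all [PC.tagOf]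
      omega
    all_goals simp_all [PC.tagOf, Msg.tagOf, NodeState.newRequest]
  | deliver j m =>
    have hmr := hr j m rfl
    rw [handle_pc]
    cases m <;> simp only [handle, Msg.tagOf] at hmr ⊢ <;> (try split_ifs) <;>
      simp_all [Emits, or_imp, Msg.tagOf]

end Event

/-- Some node has completely sent `goodLA` with tag `r` to all. -/
def GoodSent (c : Config Val n) (r : ℕ) : Prop :=
  ∃ z, ∀ l, (∃ τ, (.goodLA r, τ) ∈ c.chan z l) ∨ (z, r) ∈ (c.state l).goodLAs

theorem GoodSent.acts {c c' : Config Val n} {i : Fin n} {s' : NodeState Val n}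
    {out : List (Send Val n)} {recv : Option (Fin n × Msg Val n)} (h : Acts f c c' i s' out recv)
    {r : ℕ} (hc : GoodSent c r) : GoodSent c' r := by
  obtain ⟨z, hz⟩ := hc
  refine ⟨z, fun l => ?_⟩
  rcases hz l with ⟨τ, hτ⟩ | h1
  · rcases h.chan_keep _ _ _ hτ with h1 | ⟨rfl, rfl⟩
    · exact .inl ⟨τ, h1⟩
    · refine .inr ?_
      have hev := h.event
      rw [h.state_self]
      cases hev
      exact Set.mem_insert _ _
  · refine .inr ?_
    by_cases hl : l = i
    · subst hl
      rw [h.state_self]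
      exact h.event.mono.2.2.2.1 h1
    · rwa [h.state_ne hl]

/-- All tags in use are at most `r`. -/
structure TagsLE (c : Config Val n) (r : ℕ) : Prop where
  maxTag : ∀ j, (c.state j).maxTag ≤ r
  ackTag : ∀ j, (c.state j).ackTag ≤ r
  pc : ∀ j, (c.state j).pc.tagOf ≤ r
  chan : ∀ a b, ∀ μ ∈ c.chan a b, μ.1.tagOf ≤ r

namespace Execution

variable (e : Execution Val n f D)

theorem wellFormed (p : ℕ) : ∀ j, ((e.cfg p).state j).pc.WellFormed ((e.cfg p).state j).maxTag := by
  refine e.invariant (P := fun c => ∀ j, (c.state j).pc.WellFormed (c.state j).maxTag) ?_ ?_ ?_ p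
  · exact fun _ => trivial
  · intro p h hc
    rwa [h.state]
  · intro p i s' out recv h hc j
    by_cases hj : j = i
    · subst hj
      rw [h.state_self]
      exact h.event.wellFormed (hc j)
    · rw [h.state_ne hj]
      exact hc j

/-- A node that is still live after the successful return completed the announcement sent in that
same step, and `GoodSent` survives a later crash of the sender. -/
theorem goodSent_of_latticeRet (p : ℕ) : ∀ j, j ∉ (e.cfg p).crashed → ∀ op ph r v,
    ((e.cfg p).state j).pc = .latticeRet op ph r (some v) → GoodSent (e.cfg p) r := by
  refine e.invariant (P := fun c => ∀ j, j ∉ c.crashed → ∀ op ph r v,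
    (c.state j).pc = .latticeRet op ph r (some v) → GoodSent c r) ?_ ?_ ?_ p
  · simp [Config.init, NodeState.init]
  · intro p h hc j hj
    unfold GoodSent
    rw [h.state, h.chan]
    exact hc j fun h' => hj (h.crashed_mono h')
  · intro p i s' out recv h hc j hj op ph r v hpc
    have hj0 : j ∉ (e.cfg p).crashed := fun h' => hj (h.crashed_mono h')
    by_cases hji : j = i
    · subst hji
      rw [h.state_self] at hpc
      rcases h.event.latticeRet_some hpc with h1 | h1
      · exact (hc j hj0 _ _ _ _ h1).acts h
      · exact ⟨j, fun l => .inl ⟨_, h.chan_sent hj l _ (h1 l)⟩⟩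
    · rw [h.state_ne hji] at hpc
      exact (hc j hj0 _ _ _ _ hpc).acts h

/-- No tag above `r` is in use unless some node has announced a good lattice operation with
tag `r`. -/
theorem goodSent_or_tagsLE (p r : ℕ) : GoodSent (e.cfg p) r ∨ TagsLE (e.cfg p) r := by
  refine e.invariant (P := fun c => GoodSent c r ∨ TagsLE c r) ?_ ?_ ?_ p
  · right
    constructor <;> simp [Config.init, NodeState.init, PC.tagOf]
  · rintro p h (h1 | ⟨h1, h2, h3, h4⟩)
    · left
      unfold GoodSent
      rwa [h.state, h.chan]
    · right
      constructor <;> first | rw [h.state] | rw [h.chan]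
      all_goals assumption
  · rintro p i s' out recv h (h1 | ⟨h1, h2, h3, h4⟩)
    · exact .inl (h1.acts h)
    · by_cases hg : GoodSent (e.cfg p) r
      · exact .inl (hg.acts h)
      have h5 := h.event.tagOf_le (h1 i) (h2 i) (h3 i)
        (fun j m hr => by
          obtain ⟨τ, hτ⟩ := h.recv_mem _ _ hr
          exact h4 _ _ _ hτ)
        -- An initial lattice operation with tag `r` has returned. If it was good, its announcement
        -- is out; if not, its node knows a tag above `r`, contrary to the bound.
        (fun op res hpc => by
          cases res with
          | some v => exact hg (e.goodSent_of_latticeRet p i h.live _ _ _ _ hpc)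
          | none =>
            have := e.wellFormed p i
            rw [hpc] at this
            exact absurd (this.2 rfl) (not_lt.2 (h1 i)))
      obtain ⟨h5, h6, h7, h8⟩ := h5
      refine .inr ⟨?_, ?_, ?_, ?_⟩
      · intro j
        by_cases hj : j = i
        · subst hj
          rwa [h.state_self]
        · rw [h.state_ne hj]
          exact h1 j
      · intro j
        by_cases hj : j = i
        · subst hj
          rwa [h.state_self]
        · rw [h.state_ne hj]
          exact h2 j
      · intro j
        by_cases hj : j = i
        · subst hj
          rwa [h.state_self]
        · rw [h.state_ne hj]
          exact h3 j
      · intro a b μ hμ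
        rcases h.chan_new _ _ _ hμ with h9 | ⟨_, _, h9⟩
        · exact h4 _ _ _ h9
        · exact h8 _ _ h9

/-! ## Operations -/

theorem OpStarts.time_succ {e : Execution Val n f D} {i : Fin n} {op : Op Val} {m : ℕ}
    (h : e.OpStarts i op m) : e.time (m + 1) = e.time m := by
  rcases e.state_succ_cases m i with h1 | ⟨out, recv, h1⟩
  · have h2 := h.1
    have h3 := h.2
    rw [pc] at h2 h3
    rw [h1, h2] at h3
    simp at h3
  · exact h1.now

theorem not_idle_of_not_returns {i : Fin n} {op : Op Val} {m P : ℕ} {t : ℝ}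
    (hs : e.OpStarts i op m) (hP : e.time P ≤ t) (hi : i ∉ (e.cfg P).crashed)
    (hret : ¬ e.OpReturnsBy i m t) {p : ℕ} (hmp : m + 1 ≤ p) (hpP : p ≤ P) : e.pc i p ≠ .idle := by
  suffices h : ∀ q, m < q → q ≤ p → e.pc i q ≠ .idle from h p hmp le_rfl
  induction p, hmp using Nat.le_induction with
  | base =>
    intro q h1 h2
    obtain rfl : q = m + 1 := by omega
    simp [hs.2]
  | succ p hp ih =>
    intro q h1 h2 hpc
    have ih := ih (by omega)
    rcases Nat.lt_or_ge q (p + 1) with h3 | h3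
    · exact ih q h1 (by omega) hpc
    obtain rfl : q = p + 1 := by omega
    exact hret ⟨p, by omega, (e.time_mono (by omega : p ≤ P)).trans hP, ih, hpc,
      e.not_crashed_of_le hpP hi⟩

theorem rank_mono {i : Fin n} {a b : ℕ} (hab : a ≤ b)
    (h : ∀ p, a ≤ p → p ≤ b → e.pc i p ≠ .idle) : (e.pc i a).rank ≤ (e.pc i b).rank := by
  induction b, hab using Nat.le_induction with
  | base => exact le_rfl
  | succ b hb ih =>
    refine (ih fun p h1 h2 => h p h1 (by omega)).trans ?_
    have h1 := h b hb (by omega)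
    have h2 := h (b + 1) (by omega) le_rfl
    unfold pc at h1 h2 ⊢
    rcases e.state_succ_cases b i with h3 | ⟨out, recv, h3⟩
    · rw [h3]
    · exact h3.event.rank_le h1 h2

/-- A new `readTag()` request can be made only from `idle`. -/
theorem req_eq_of_readWait {i : Fin n} {a b : ℕ} (hab : a ≤ b) {op : Op Val}
    (hb : e.pc i b = .readWait op)
    (h : ∀ p, a ≤ p → p ≤ b → e.pc i p ≠ .idle) :
    ((e.cfg b).state i).req = ((e.cfg a).state i).req := by
  induction b, hab using Nat.le_induction generalizing op with
  | base => rfl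
  | succ b hb' ih =>
    have h0 := h b hb' (by omega)
    unfold pc at hb h0
    rcases e.state_succ_cases b i with h3 | ⟨out, recv, h3⟩
    · rw [h3] at hb ⊢
      exact ih hb fun p h1 h2 => h p h1 (by omega)
    · have hev := h3.event
      rcases hev.readWait hb with ⟨h4, h5⟩ | ⟨h4, _⟩
      · exact h5.trans (ih h4 fun p h1 h2 => h p h1 (by omega))
      · exact absurd (hev.idle_of_readWait hb (by omega)) h0

theorem borrowWait_mono {i : Fin n} {a b : ℕ} (hab : a ≤ b) {op : Op Val} {r : ℕ}
    (ha : e.pc i a = .borrowWait op r) (h : ∀ p, a ≤ p → p ≤ b → e.pc i p ≠ .idle) :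
    e.pc i b = .borrowWait op r := by
  induction b, hab using Nat.le_induction with
  | base => exact ha
  | succ b hb ih =>
    have h1 := ih fun p h1 h2 => h p h1 (by omega)
    have h2 := h (b + 1) (by omega) le_rfl
    unfold pc at h1 h2 ⊢
    rcases e.state_succ_cases b i with h3 | ⟨out, recv, h3⟩
    · rwa [h3]
    · exact h3.event.borrowWait h1 h2

theorem exists_latticeStarts {i : Fin n} {p : ℕ} {op : Op Val} {ph r : ℕ}
    (h : (e.pc i p).InLattice op ph r) : ∃ m, m < p ∧ e.LatticeStarts i op ph r m ∧
      ∀ q, m < q → q ≤ p → (e.pc i q).InLattice op ph r := by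
  induction p with
  | zero => simp [pc, e.init, Config.init, NodeState.init, PC.InLattice] at h
  | succ p ih =>
    have key : (e.pc i p).InLattice op ph r ∨ e.LatticeStarts i op ph r p := by
      unfold pc at h ⊢
      rcases e.state_succ_cases p i with h1 | ⟨out, recv, h1⟩
      · rw [h1] at h
        exact .inl h
      · exact (h1.event.inLattice h).imp_right fun h2 => ⟨h2.1, h2.2.1⟩
    have hlast : ∀ q, p < q → q ≤ p + 1 → (e.pc i q).InLattice op ph r := fun q h1 h2 => by
      obtain rfl : q = p + 1 := by omega
      exact h
    rcases key with h1 | h1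
    · obtain ⟨m, h2, h3, h4⟩ := ih h1
      exact ⟨m, by omega, h3, fun q h5 h6 => (Nat.lt_or_ge p q).elim (fun h7 => hlast q h7 h6)
        fun h7 => h4 q h5 h7⟩
    · exact ⟨p, by omega, h1, hlast⟩

variable {e} in
theorem LastUpTo.not_latticeRet {θ : ℝ} {p : ℕ} (hp : e.LastUpTo θ p) {i : Fin n}
    (hi : i ∉ (e.cfg p).crashed) {op : Op Val} {ph r : ℕ} {res : Option (View Val n)} :
    ((e.cfg p).state i).pc ≠ .latticeRet op ph r res := by
  intro hpc
  have hblk := hp.blocked i hi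
  have hwf := e.wellFormed p i
  rw [hpc] at hwf
  rcases Nat.eq_zero_or_pos ph with rfl | h0
  · exact hblk _ _ (.afterPhaseZero _ op r res hpc)
  cases res with
  | some v => exact hblk _ _ (.direct _ op ph r v hpc h0)
  | none =>
    obtain rfl | h3 : ph = 3 ∨ ph = 1 ∨ ph = 2 := by have := hwf.1; omega
    · exact hblk _ _ (.leaveLoop _ op r hpc)
    · exact hblk _ _ (.nextPhase _ op ph r hpc h3)

/-- In a `LastUpTo` configuration a live client is neither at a call nor at a return of `Lattice`,
so rank exactly `k + 1` means being inside the lattice operation of phase `k`; within `B` it returns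
and the rank rises. -/
theorem rank_of_lastUpTo (hf : f < n) (hD : 0 < D) {i : Fin n} {θ B : ℝ} {a b P k : ℕ}
    (hB : (5 + 3 * (⌈√(e.crashes : ℝ)⌉₊ : ℝ)) * D ≤ B) (hk : k < 4)
    (ha : e.LastUpTo θ a) (hb : e.LastUpTo (θ + B) b) (hab : a ≤ b) (hbP : b ≤ P)
    (hi : i ∉ (e.cfg P).crashed) (hidle : ∀ p, a ≤ p → p ≤ P → e.pc i p ≠ .idle)
    (hrank : k + 1 ≤ (e.pc i a).rank) : k + 2 ≤ (e.pc i b).rank := by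
  have hia := e.not_crashed_of_le (hab.trans hbP) hi
  have hib := e.not_crashed_of_le hbP hi
  by_cases h1 : k + 2 ≤ (e.pc i a).rank
  · exact h1.trans (e.rank_mono hab fun p h2 h3 => hidle p h2 (by omega))
  have hin : ∃ op r, (e.pc i a).InLattice op k r := by
    have hblk := ha.blocked i hia
    unfold pc at hrank h1 ⊢
    cases hpc : ((e.cfg a).state i).pc with
    | idle => simp [hpc, PC.rank] at hrank
    | readWait op => simp [hpc, PC.rank] at hrank
    | latticeCall op ph r => exact absurd (.latticeStart _ op ph r hpc) (hblk _ _)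
    | writeWait op ph r =>
      simp only [hpc, PC.rank] at hrank h1
      obtain rfl : ph = k := by omega
      exact ⟨op, r, .inl rfl⟩
    | eqWait op ph r =>
      simp only [hpc, PC.rank] at hrank h1
      obtain rfl : ph = k := by omega
      exact ⟨op, r, .inr rfl⟩
    | latticeRet op ph r res =>
      simp only [hpc, PC.rank] at h1
      exact absurd hpc (ha.not_latticeRet hia)
    | borrowWait op r =>
      simp only [hpc, PC.rank] at h1
      omega
  obtain ⟨op, r, hin⟩ := hin
  obtain ⟨m, hma, hs, hm⟩ := e.exists_latticeStarts hin
  rcases e.lattice_returns hf hD hB hs with ⟨m', h2, h3, h4, ⟨res, h5⟩, h6⟩ | ⟨q, h2, h3⟩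
  · have hmt : e.time m ≤ θ := (e.time_mono hma.le).trans ha.time_le
    have h7 : m' ≤ b := hb.le_of_time_le (by linarith)
    -- The step after `b` is a passage of time and changes no local state, so the return is already
    -- visible in the `b`-th configuration.
    have h8 : m' ≠ b := by
      rintro rfl
      have h9 := h4 m' h2 le_rfl
      rw [pc, hb.state_succ] at h5
      rw [pc, h5] at h9
      simp at h9
    have h9 : a < m' + 1 := by
      by_contra! h10
      have := hm (m' + 1) (by omega) h10
      simp [PC.InLattice, h5] at this
    have h10 := e.rank_mono (i := i) (show m' + 1 ≤ b by omega)
      fun p h11 h12 => hidle p (by omega) (by omega)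
    rw [h5] at h10
    exact h10
  · have hmt : e.time m ≤ θ := (e.time_mono hma.le).trans ha.time_le
    exact absurd (e.crashed_mono (hb.le_of_time_le (by linarith)) h2) hib

theorem op_returns (hf : f < n) (hD : 0 < D) {i : Fin n} {op : Op Val} {m : ℕ} {B C : ℝ}
    (hB : (5 + 3 * (⌈√(e.crashes : ℝ)⌉₊ : ℝ)) * D ≤ B) (hC : 3 * D + 4 * B ≤ C)
    (hs : e.OpStarts i op m) :
    e.OpReturnsBy i m (e.time m + C) ∨ e.CrashedBy i (e.time m + C) := by
  by_contra! hc
  obtain ⟨hret, hcr⟩ := hc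
  have ht0 := e.time_nonneg m
  have hB0 : 0 ≤ B := le_trans (by positivity) hB
  have hts := hs.time_succ
  obtain ⟨P, hP⟩ := e.exists_lastUpTo (θ := e.time m + C) (by linarith)
  have hiP : i ∉ (e.cfg P).crashed := fun h => hcr ⟨P, h, hP.time_le⟩
  have hidle : ∀ p, m + 1 ≤ p → p ≤ P → e.pc i p ≠ .idle := fun p h1 h2 =>
    e.not_idle_of_not_returns hs hP.time_le hiP hret h1 h2
  obtain ⟨p₀, h₀⟩ := e.exists_lastUpTo (θ := e.time m + 2 * D) (by linarith)
  obtain ⟨p₁, h₁⟩ := e.exists_lastUpTo (θ := e.time m + 2 * D + B) (by linarith)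
  obtain ⟨p₂, h₂⟩ := e.exists_lastUpTo (θ := e.time m + 2 * D + B + B) (by linarith)
  obtain ⟨p₃, h₃⟩ := e.exists_lastUpTo (θ := e.time m + 2 * D + B + B + B) (by linarith)
  obtain ⟨p₄, h₄⟩ := e.exists_lastUpTo (θ := e.time m + 2 * D + B + B + B + B) (by linarith)
  obtain ⟨p₅, h₅⟩ := e.exists_lastUpTo (θ := e.time m + 2 * D + B + B + B + B + D) (by linarith)
  have hm0 : m + 1 ≤ p₀ := h₀.le_of_time_le (by linarith)
  have h01 := h₀.mono h₁ (by linarith)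
  have h12 := h₁.mono h₂ (by linarith)
  have h23 := h₂.mono h₃ (by linarith)
  have h34 := h₃.mono h₄ (by linarith)
  have h45 := h₄.mono h₅ (by linarith)
  have h5P := h₅.mono hP (by linarith)
  have r₀ : 0 + 1 ≤ (e.pc i p₀).rank := by
    have hi0 := e.not_crashed_of_le (show p₀ ≤ P by omega) hiP
    have hid := hidle p₀ hm0 (by omega)
    have hblk := h₀.blocked i hi0
    unfold pc at hid ⊢
    cases hpc : ((e.cfg p₀).state i).pc with
    | idle => exact absurd hpc hid
    | readWait op' =>
      exfalso
      have hcard := e.card_acks (by linarith) hD h₀ (by linarith) hi0 (.inl ⟨op, hs.2⟩)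
        (e.req_eq_of_readWait hm0 hpc fun p h1 h2 => hidle p h1 (by omega))
      cases op' with
      | update v => exact hblk _ _ (.readDoneUpdate _ v hpc hcard)
      | scan => exact hblk _ _ (.readDoneScan _ hpc hcard)
    | _ => simp [PC.rank]
  have r₁ := e.rank_of_lastUpTo (k := 0) hf hD hB (by omega) h₀ h₁ h01 (by omega : p₁ ≤ P) hiP
    (fun p h1 h2 => hidle p (by omega) h2) r₀
  have r₂ := e.rank_of_lastUpTo (k := 1) hf hD hB (by omega) h₁ h₂ h12 (by omega : p₂ ≤ P) hiP
    (fun p h1 h2 => hidle p (by omega) h2) r₁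
  have r₃ := e.rank_of_lastUpTo (k := 2) hf hD hB (by omega) h₂ h₃ h23 (by omega : p₃ ≤ P) hiP
    (fun p h1 h2 => hidle p (by omega) h2) r₂
  have r₄ := e.rank_of_lastUpTo (k := 3) hf hD hB (by omega) h₃ h₄ h34 (by omega : p₄ ≤ P) hiP
    (fun p h1 h2 => hidle p (by omega) h2) r₃
  have hi4 := e.not_crashed_of_le (show p₄ ≤ P by omega) hiP
  have hi5 := e.not_crashed_of_le h5P hiP
  have hwf := e.wellFormed p₄ i
  obtain ⟨op', r, hpc⟩ : ∃ op' r, e.pc i p₄ = .borrowWait op' r := by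
    unfold pc at r₄ ⊢
    cases hpc : ((e.cfg p₄).state i).pc with
    | borrowWait op' r => exact ⟨op', r, rfl⟩
    | latticeRet op ph r res => exact absurd hpc (h₄.not_latticeRet hi4)
    | _ =>
      simp only [hpc, PC.WellFormed, PC.rank] at hwf r₄
      omega
  have hpc5 := e.borrowWait_mono h45 hpc fun p h1 h2 => hidle p (by omega) (by omega)
  rw [pc] at hpc
  rw [hpc] at hwf
  -- `PC.WellFormed` records that the waiting node itself knows a tag above `r`, so the announcement
  -- with tag `r` has been sent to all and arrives within `D`.
  obtain ⟨z, hz⟩ := (e.goodSent_or_tagsLE p₄ r).resolve_right fun h =>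
    absurd (h.maxTag i) (not_le.2 hwf)
  refine h₅.blocked i hi5 _ _ (.indirect _ op' r z hpc5 ?_)
  rcases hz i with ⟨τ, hτ⟩ | h
  · have h1 : τ ≤ e.time p₄ := e.sent_le_now _ _ _ _ hτ
    obtain ⟨b, _, h2, h3⟩ := e.handles_of_mem h₅ hi5 (by linarith [h₄.time_le]) h45 hτ
    refine e.goodLAs_mono i (show b + 1 ≤ p₅ from h2) ?_
    simp only [h3.state]
    exact Set.mem_insert _ _
  · exact e.goodLAs_mono i h45 h

/-- Since `⌈√k⌉ ≤ √k + 1`, the factor is at most `8 + 3√k`, whence `11`. -/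
theorem mul_ceil_sqrt_le (hD : 0 < D) :
    (5 + 3 * (⌈√(e.crashes : ℝ)⌉₊ : ℝ)) * D ≤ 11 * max 1 √(e.crashes : ℝ) * D := by
  have h1 := Nat.ceil_lt_add_one (Real.sqrt_nonneg (e.crashes : ℝ))
  have h2 := le_max_left 1 √(e.crashes : ℝ)
  have h3 := le_max_right 1 √(e.crashes : ℝ)
  gcongr
  linarith

end Execution

end ACASO

theorem mainTheorem2 :
    ∃ C : ℝ, 0 < C ∧
      ∀ (Val : Type*) (n f : ℕ) (_ : 2 * f < n) (D : ℝ) (_ : 0 < D)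
        (e : ACASO.Execution Val n f D),
        (∀ (i : Fin n) (op : ACASO.Op Val) (ph r m : ℕ), e.LatticeStarts i op ph r m →
          e.LatticeReturnsBy i op ph r m (e.time m + C * max 1 (√(e.crashes : ℝ)) * D) ∨
          e.CrashedBy i (e.time m + C * max 1 (√(e.crashes : ℝ)) * D)) ∧
        (∀ (i : Fin n) (op : ACASO.Op Val) (m : ℕ), e.OpStarts i op m →
          e.OpReturnsBy i m (e.time m + C * max 1 (√(e.crashes : ℝ)) * D) ∨
          e.CrashedBy i (e.time m + C * max 1 (√(e.crashes : ℝ)) * D)) := by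
  -- `47 = 3 + 4 * 11`: reading the tag and waiting for `goodLA` take `3D`, and each of four lattice
  -- operations costs `11 * max 1 √k * D`.
  refine ⟨47, by norm_num, fun Val n f hf D hD e => ?_⟩
  have hB := e.mul_ceil_sqrt_le hD
  have h1 : D ≤ max 1 √(e.crashes : ℝ) * D :=
    le_mul_of_one_le_left hD.le (le_max_left _ _)
  exact ⟨fun i op ph r m hs => e.lattice_returns (by omega) hD (hB.trans (by linarith)) hs,
    fun i op m hs => e.op_returns (by omega) hD hB (by linarith) hs⟩
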